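/- Let $d\ge 1$, $\lambda>0$, let $S_+^{d-1}=\{v\in\mathbb{R}^d:\|v\|=1,\ v_d\ge 0\}$, let $B_r^d$ be the closed ball of radius $r$ centred at the origin, and put $H(p,v)=\{x\in\mathbb{R}^d:\langle x,v\rangle=p\}$ for $(p,v)\in\mathbb{R}\times S_+^{d-1}$. Let $\Theta$ be a probability measure on $\mathcal{B}(S_+^{d-1})$ that is nondegenerate, i.e. $\Theta(L\cap S_+^{d-1})<1$ for every $(d-1)$-dimensional linear subspace $L$ of $\mathbb{R}^d$. Let $\Psi=\sum_{i\ge1}\delta_{(P_i,V_i)}$ represent a stationary Poisson hyperplane process in $\mathbb{R}^d$ with intensity $\lambda$ and orientation distribution $\Theta$; that is, $\Psi$ is a Poisson point process on $\mathbb{R}\times S_+^{d-1}$ with intensity measure $\lambda\,(\mathrm{Lebesgue}\otimes\Theta)$, and the hyperplanes are $H(P_i,V_i)$. Fix a linear order $\preceq$ on $S_+^{d-1}$ for which $\{(u,v):u\preceq v\}$ is a measurable set, and write $(v_{(1)},\dots,v_{(d)})$ for the $\preceq$-increasing rearrangement of $(v_1,\dots,v_d)$. For $B\in\mathcal{B}((S_+^{d-1})^d)$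 and $r\in\mathbb{R}$ (with $B_r^d=\emptyset$ for $r<0$), let $\Psi_0(B_r^d\times B)$ be $\frac1{d!}$ times the number of $d$-tuples of pairwise distinct indices $(i_1,\dots,i_d)$ such that $H(P_{i_1},V_{i_1})\cap\dots\cap H(P_{i_d},V_{i_d})$ is a single point lying in $B_r^d$ and $(V_{(i_1)},\dots,V_{(i_d)})\in B$, that is, the number of vertices in $B_r^d$ with marks in $B$. For a fixed $\rho>0$, let $X_1,X_2,\dots$ be i.i.d. with law $\mathrm{Unif}[-\rho,\rho]\otimes\Theta$, let $$f_B((p_1,v_1),\dots,(p_d,v_d))=\mathbf 1\{H(p_1,v_1)\cap\dots\cap H(p_d,v_d)\cap B_\rho^d\ne\emptyset\}\,\mathbf 1_B(v_{(1)},\dots,v_{(d)}),$$ and let $\sigma_B^{(1,d)}=\mathbb{E}\big[f_B(X_1,\dots,X_d)\,f_B(X_d,\dots,X_{2d-1})\big]$. (The values of $\mathbb{E}f_B(X_1,\dots,X_d)$ and $\sigma_B^{(1,d)}$ do not depend on $\rho$.) Theorem. Let $B\in\mathcal{B}((S_+^{d-1})^d)$ be such that $\sigma_B^{(1,d)}>0$.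 Then $\Psi_0(B_r^d\times B)$ is almost surely finite for every $r$, and $$\frac{(d-1)!}{(2\lambda r)^{d-1/2}}\left(\Psi_0(B_r^d\times B)-\frac{(2\lambda r)^d}{d!}\,\mathbb{E}f_B(X_1,\dots,X_d)\right)\xrightarrow[r\to\infty]{d}\mathcal{N}(0,\sigma_B^{(1,d)}).$$ -/

import Mathlib

open MeasureTheory ProbabilityTheory Filter
open scoped ENNReal NNReal Topology

namespace PoissonHyperplane

/-- The closed upper unit hemisphere of `ℝ^d`: unit vectors with nonnegative last coordinate. -/
abbrev UpperHemisphere (d : ℕ) : Type :=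
  {v : EuclideanSpace ℝ (Fin d) // ‖v‖ = 1 ∧ ∀ i : Fin d, (i : ℕ) + 1 = d → 0 ≤ v i}

/-- The hyperplane `H(p, v) = {x : ⟨x, v⟩ = p}`, parametrized by its signed distance `p` from the
origin and its orientation vector `v`. -/
def hyperplane {d : ℕ} (q : ℝ × UpperHemisphere d) : Set (EuclideanSpace ℝ (Fin d)) :=
  {x | inner ℝ x (q.2 : EuclideanSpace ℝ (Fin d)) = q.1}

/-- The intersection of `d` hyperplanes. -/
def flatInter {d : ℕ} (q : Fin d → ℝ × UpperHemisphere d) : Set (EuclideanSpace ℝ (Fin d)) :=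
  ⋂ j, hyperplane (q j)

/-- The orientation vectors of `d` hyperplanes, rearranged in increasing order. -/
def sortedMarks {d : ℕ} [LinearOrder (UpperHemisphere d)] (q : Fin d → ℝ × UpperHemisphere d) :
    Fin d → UpperHemisphere d :=
  (fun j => (q j).2) ∘ Tuple.sort (fun j => (q j).2)

/-- The orientation distribution is nondegenerate: it is not concentrated on a linear
hyperplane. -/
def Nondegenerate {d : ℕ} (Θ : Measure (UpperHemisphere d)) : Prop :=
  ∀ L : Submodule ℝ (EuclideanSpace ℝ (Fin d)), Module.finrank ℝ L + 1 = d →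
    Θ {v | (v : EuclideanSpace ℝ (Fin d)) ∈ L} < 1

/-- The random counting measure `∑ᵢ δ_{X i}`. -/
noncomputable def countingMeasure {Ω E : Type*} [MeasurableSpace E] (X : ℕ → Ω → E) (ω : Ω) :
    Measure E :=
  Measure.sum fun i => Measure.dirac (X i ω)

/-- `∑ᵢ δ_{X i}` is a Poisson point process on `E` with intensity measure `Λ`: the number of points
in a set of finite intensity is Poisson distributed, and the numbers of points in pairwise disjoint
sets are independent. -/
structure IsPoissonProcess {Ω E : Type*} [MeasurableSpace Ω] [MeasurableSpace E]
    (X : ℕ → Ω → E) (Λ : Measure E) (P : Measure Ω) : Prop where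
  measurable : ∀ i, Measurable (X i)
  hasLaw_count : ∀ A : Set E, MeasurableSet A → Λ A ≠ ∞ →
    HasLaw (fun ω => countingMeasure X ω A)
      ((poissonMeasure (Λ A).toNNReal).map (fun n : ℕ => (n : ℝ≥0∞))) P
  indep : ∀ (n : ℕ) (A : Fin n → Set E), (∀ i, MeasurableSet (A i)) →
    Pairwise (fun i j => Disjoint (A i) (A j)) →
    iIndepFun (fun i ω => countingMeasure X ω (A i)) P

/-- The marked point process representation of a stationary Poisson hyperplane process of intensity
`lam` and orientation distribution `Θ`: the pairs of signed distances and orientation vectors form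
a Poisson process with intensity measure `lam • (Lebesgue ⊗ Θ)`. -/
def IsStationaryPoissonHyperplaneProcess {Ω : Type*} [MeasurableSpace Ω] {d : ℕ}
    (X : ℕ → Ω → ℝ × UpperHemisphere d) (lam : ℝ) (Θ : Measure (UpperHemisphere d))
    (P : Measure Ω) : Prop :=
  IsPoissonProcess X (ENNReal.ofReal lam • ((volume : Measure ℝ).prod Θ)) P

open Classical in
/-- `Ψ₀(A × B)`, the number of intersection points (of `d` distinct hyperplanes meeting in exactly
one point) that lie in `A` and whose ordered vector of orientation vectors lies in `B`. The sum runs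
over ordered `d`-tuples of pairwise distinct indices, so that it is divided by `d!`. -/
noncomputable def vertexCount {Ω : Type*} {d : ℕ} [LinearOrder (UpperHemisphere d)]
    (X : ℕ → Ω → ℝ × UpperHemisphere d) (A : Set (EuclideanSpace ℝ (Fin d)))
    (B : Set (Fin d → UpperHemisphere d)) (ω : Ω) : ℝ≥0∞ :=
  (∑' i : Fin d ↪ ℕ,
    if (∃ x ∈ A, flatInter (fun j => X (i j) ω) = {x}) ∧ sortedMarks (fun j => X (i j) ω) ∈ B
    then 1 else 0) / (d.factorial : ℝ≥0∞)

open Classical in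
/-- The kernel `f_B` for the ball of radius `r`: it is `1` if the `d` hyperplanes have a common
point in the ball and their ordered orientation vectors form an element of `B`, and `0`
otherwise. -/
noncomputable def kernelB {d : ℕ} [LinearOrder (UpperHemisphere d)]
    (r : ℝ) (B : Set (Fin d → UpperHemisphere d)) (q : Fin d → ℝ × UpperHemisphere d) : ℝ :=
  if (flatInter q ∩ Metric.closedBall 0 r).Nonempty ∧ sortedMarks q ∈ B then 1 else 0

/-- The law of one hyperplane `(P, V)` hitting the ball of radius `r`: `P` is uniform on `[-r, r]`,
`V` has law `Θ`, and they are independent. -/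
noncomputable def hittingLaw {d : ℕ} (r : ℝ) (Θ : Measure (UpperHemisphere d)) :
    Measure (ℝ × UpperHemisphere d) :=
  (cond (volume : Measure ℝ) (Set.Icc (-r) r)).prod Θ

/-- `E f_B(X₁, …, X_d)` for i.i.d. `Xᵢ` with law `hittingLaw r Θ`. -/
noncomputable def meanB {d : ℕ} [LinearOrder (UpperHemisphere d)]
    (r : ℝ) (Θ : Measure (UpperHemisphere d)) (B : Set (Fin d → UpperHemisphere d)) : ℝ :=
  ∫ q, kernelB r B q ∂(Measure.pi fun _ : Fin d => hittingLaw r Θ)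

/-- `σ_B^{(1,d)} = E[f_B(X₁, …, X_d) f_B(X_d, …, X_{2d-1})]` for i.i.d. `Xᵢ` with law
`hittingLaw r Θ`. -/
noncomputable def sigmaB {d : ℕ} [LinearOrder (UpperHemisphere d)]
    (r : ℝ) (Θ : Measure (UpperHemisphere d)) (B : Set (Fin d → UpperHemisphere d)) : ℝ :=
  ∫ q : Fin (2 * d - 1) → ℝ × UpperHemisphere d,
    kernelB r B (fun j : Fin d => q ⟨j, by omega⟩) *
      kernelB r B (fun j : Fin d => q ⟨d - 1 + j, by omega⟩)
    ∂(Measure.pi fun _ : Fin (2 * d - 1) => hittingLaw r Θ)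

end PoissonHyperplane

namespace PoissonHyperplane

/-! Up to the factor `d!`, the vertex count is a U-statistic `W` of the Poisson process: the sum
over tuples of distinct points of a symmetric `{0,1}`-valued kernel `g`. The kernel vanishes unless
all signed distances lie in `[-r, r]`, and on that strip the intensity is `m • μ` with `m = 2 * lam
* r` and `μ` a probability measure. So the limit `r → ∞` is a limit `m → ∞`.

The proof compares `W` with its linear part (Hájek projection). Let `H x` be the mean of `g` with
one argument fixed at `x` (`firstMarginal`), and let `L` be the sum of `H` over the points. By
Campbell's formula (`factorialMoment_eq_pi`), moments are sums over the ways in which two tuples can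
share points. In `E W²`, pairs with no shared point give `(E W)²`, pairs with one give `d² m^(2d-1)
E H²`, and the rest are `O(m^(2d-2))` (`lintegral_uStat_sq_le`). Together with the matching bounds
for `E L²` and `E W L`, all leading terms cancel in `E (W - E W - d m^(d-1) (L - E L))²`, which is
therefore `O(m^(2d-2))` (`integral_linearization_sq_le`). On the scale `d m^(d-1/2)` this difference
vanishes in probability.

It remains to treat `L`. Its characteristic function is the exponential of `∫ (exp(itH) - 1)`
against the intensity (`IsPoissonProcess.charFun_linear`), obtained by rounding `H` to finitely many
values and using independence of counts. A Taylor expansion gives the Gaussian limit with variance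
`E H²` (`tendstoInDistribution_linear`), and Slutsky's theorem transfers it to `W`
(`tendstoInDistribution_uStat`).

Geometry enters in two places. Dilations map the problem for one radius to that for another, so `E
g` and `E H²` do not depend on `r`. Hyperplanes with dependent normals almost surely have no common
point (`measure_degenerate_eq_zero`), so "meet in exactly one point" may be replaced by "meet",
which identifies the two constants with `meanB` and `sigmaB`. -/

/-! ### Poisson counts and sums over tuples of distinct points -/

lemma tsum_prod_fin (n : ℕ) (f : Fin n → ℕ → ℝ≥0∞) :
    ∑' φ : Fin n → ℕ, ∏ j, f j (φ j) = ∏ j, ∑' i, f j i := by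
  induction n with
  | zero => simp [tsum_fintype]
  | succ n ih =>
    rw [← (Fin.consEquiv fun _ => ℕ).tsum_eq, ENNReal.tsum_prod', Fin.prod_univ_succ, ← ih,
      ← ENNReal.tsum_mul_right]
    refine tsum_congr fun i => ?_
    rw [← ENNReal.tsum_mul_left]
    refine tsum_congr fun φ => ?_
    simp [Fin.prod_univ_succ, Fin.consEquiv]

lemma tsum_prod_pi {ι : Type*} [Fintype ι] (f : ι → ℕ → ℝ≥0∞) :
    ∑' φ : ι → ℕ, ∏ j, f j (φ j) = ∏ j, ∑' i, f j i := by
  have e := Fintype.equivFin ι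
  rw [← e.symm.prod_comp, ← tsum_prod_fin, ← (e.arrowCongr (Equiv.refl ℕ)).symm.tsum_eq]
  refine tsum_congr fun φ => ?_
  rw [← e.symm.prod_comp]
  simp

/-- Makes sums over tuples of distinct indices countable sums, hence measurable and integrable term
by term. -/
instance countable_embedding_nat {ι : Type*} [Finite ι] : Countable (ι ↪ ℕ) :=
  DFunLike.coe_injective.countable

lemma countingMeasure_apply {Ω E : Type*} [MeasurableSpace E] (X : ℕ → Ω → E) (ω : Ω) {A : Set E} (hA : MeasurableSet A) :
    countingMeasure X ω A = ∑' i, A.indicator 1 (X i ω) := by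
  simp [countingMeasure, Measure.sum_apply _ hA, Measure.dirac_apply' _ hA]

/-- Turns a coincidence of two points into an event about counts, whose law is what the definition
of a Poisson process provides. -/
lemma two_le_countingMeasure {Ω E : Type*} [MeasurableSpace E] {X : ℕ → Ω → E} {ω : Ω} {A : Set E}
    (hA : MeasurableSet A) {i j : ℕ} (hij : i ≠ j) (hi : X i ω ∈ A) (hj : X j ω ∈ A) : 2 ≤ countingMeasure X ω A := by
  rw [countingMeasure_apply X ω hA]
  refine le_trans ?_ (ENNReal.sum_le_tsum {i, j})
  rw [Finset.sum_pair hij]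
  simp [hi, hj, one_add_one_eq_two]

section Count

variable {Ω E : Type*} [MeasurableSpace Ω] [MeasurableSpace E] {X : ℕ → Ω → E} {Λ : Measure E}
  {P : Measure Ω}

lemma measurable_countingMeasure (hX : ∀ i, Measurable (X i)) {A : Set E} (hA : MeasurableSet A) :
    Measurable fun ω => countingMeasure X ω A := by
  simp_rw [countingMeasure_apply X _ hA]
  exact Measurable.tsum fun i => (measurable_one.indicator hA).comp (hX i)

lemma lintegral_natCast_poissonMeasure (r : ℝ≥0) :
    ∫⁻ n, (n : ℝ≥0∞) ∂(poissonMeasure r) = r := by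
  -- The factor `n + 1` cancels in the factorial, which shifts the Poisson weights by one and leaves
  -- `r` times their total mass.
  have h1 : ∀ n : ℕ, ENNReal.ofReal (Real.exp (-r) * r ^ (n + 1) / (n + 1).factorial) *
      ((n + 1 : ℕ) : ℝ≥0∞) = r * ENNReal.ofReal (Real.exp (-r) * r ^ n / n.factorial) := by
    intro n
    rw [← ENNReal.ofReal_coe_nnreal, ← ENNReal.ofReal_natCast, ← ENNReal.ofReal_mul (by positivity),
      ← ENNReal.ofReal_mul (by positivity)]
    congr 1
    rw [Nat.factorial_succ]
    push_cast
    field_simp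
    ring
  simp only [poissonMeasure, lintegral_sum_measure, lintegral_smul_measure, lintegral_dirac,
    smul_eq_mul]
  rw [tsum_eq_zero_add' ENNReal.summable]
  simp_rw [h1]
  rw [ENNReal.tsum_mul_left, ← ENNReal.ofReal_tsum_of_nonneg (fun n => by positivity)
    (hasSum_one_poissonMeasure r).summable, (hasSum_one_poissonMeasure r).tsum_eq]
  simp

lemma IsPoissonProcess.lintegral_count (hX : IsPoissonProcess X Λ P) {A : Set E}
    (hA : MeasurableSet A) (hΛ : Λ A ≠ ∞) : ∫⁻ ω, countingMeasure X ω A ∂P = Λ A := by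
  have h := (hX.hasLaw_count A hA hΛ).map_eq
  have := lintegral_map (μ := P) (f := fun x : ℝ≥0∞ => x) measurable_id
    (measurable_countingMeasure hX.measurable hA)
  rw [← this, h, lintegral_map (f := fun x : ℝ≥0∞ => x) measurable_id (by fun_prop),
    lintegral_natCast_poissonMeasure]
  exact ENNReal.coe_toNNReal hΛ

/-- Since `exp(-r) ≥ 1 - r`, one has `1 - exp(-r) (1 + r) ≤ 1 - (1 - r)(1 + r) = r²`. -/
lemma poissonMeasure_Ici_two_le (r : ℝ≥0) : poissonMeasure r (Set.Ici 2) ≤ (r : ℝ≥0∞) ^ 2 := by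
  have h : (Set.Ici 2 : Set ℕ) = {0, 1}ᶜ := by
    ext n; simp only [Set.mem_Ici, Set.mem_compl_iff, Set.mem_insert_iff, Set.mem_singleton_iff]
    omega
  have h2 : (poissonMeasure r).real (Set.Ici 2) ≤ (r : ℝ) ^ 2 := by
    rw [h, probReal_compl_eq_one_sub (by measurability), Set.insert_eq,
      measureReal_union (by simp) (by measurability), poissonMeasure_real_singleton,
      poissonMeasure_real_singleton]
    have := Real.add_one_le_exp (-(r : ℝ))
    have hr : (0 : ℝ) ≤ r := r.2
    simp
    nlinarith
  rw [← ENNReal.ofReal_toReal (measure_ne_top (poissonMeasure r) (Set.Ici 2))]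
  calc _ ≤ ENNReal.ofReal ((r : ℝ) ^ 2) := ENNReal.ofReal_le_ofReal h2
    _ = _ := by rw [ENNReal.ofReal_pow (NNReal.coe_nonneg r), ENNReal.ofReal_coe_nnreal]

lemma IsPoissonProcess.measure_two_le_count (hX : IsPoissonProcess X Λ P) {A : Set E}
    (hA : MeasurableSet A) (hΛ : Λ A ≠ ∞) : P {ω | 2 ≤ countingMeasure X ω A} ≤ Λ A ^ 2 := by
  have h := (hX.hasLaw_count A hA hΛ).map_eq
  have h2 : P {ω | 2 ≤ countingMeasure X ω A}
      = P.map (fun ω => countingMeasure X ω A) (Set.Ici 2) := by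
    rw [Measure.map_apply (measurable_countingMeasure hX.measurable hA) measurableSet_Ici]
    rfl
  rw [h2, h, Measure.map_apply (by fun_prop) measurableSet_Ici]
  have h3 : (fun n : ℕ => (n : ℝ≥0∞)) ⁻¹' Set.Ici 2 = Set.Ici 2 := by
    ext n; simp only [Set.mem_preimage, Set.mem_Ici]; norm_cast
  rw [h3]
  refine (poissonMeasure_Ici_two_le _).trans ?_
  rw [ENNReal.coe_toNNReal hΛ]

/-- The factorial moment measure of a Poisson process evaluated at a product of pairwise disjoint
sets. -/
lemma IsPoissonProcess.lintegral_tsum_embedding_prod (hX : IsPoissonProcess X Λ P) {ι : Type*}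
    [Fintype ι] (A : ι → Set E) (hA : ∀ j, MeasurableSet (A j)) (hΛ : ∀ j, Λ (A j) ≠ ∞)
    (hd : Pairwise fun j k => Disjoint (A j) (A k)) :
    ∫⁻ ω, ∑' e : ι ↪ ℕ, ∏ j, (A j).indicator 1 (X (e j) ω) ∂P = ∏ j, Λ (A j) := by
  have h1 : ∀ ω, ∑' e : ι ↪ ℕ, ∏ j, (A j).indicator (1 : E → ℝ≥0∞) (X (e j) ω)
      = ∏ j, countingMeasure X ω (A j) := by
    intro ω
    simp_rw [countingMeasure_apply X ω (hA _)]
    rw [← tsum_prod_pi fun j i => (A j).indicator (1 : E → ℝ≥0∞) (X i ω)]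
    -- As the sets are disjoint, an index tuple with nonzero product is automatically injective. So
    -- the sum over embeddings equals the sum over all tuples, and the latter factors.
    refine Function.Injective.tsum_eq (g := fun e : ι ↪ ℕ => (e : ι → ℕ)) DFunLike.coe_injective
      (f := fun φ => ∏ j, (A j).indicator (1 : E → ℝ≥0∞) (X (φ j) ω)) ?_
    intro φ hφ
    have hmem : ∀ j, X (φ j) ω ∈ A j := by
      intro j
      by_contra hj
      exact hφ (Finset.prod_eq_zero (Finset.mem_univ j) (by simp [hj]))
    refine ⟨⟨φ, fun j k hjk => ?_⟩, rfl⟩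
    by_contra hne
    exact Set.disjoint_left.1 (hd hne) (hmem j) (hjk ▸ hmem k)
  simp_rw [h1]
  have e := Fintype.equivFin ι
  have hind : iIndepFun (fun j ω => countingMeasure X ω (A j)) P := by
    have := (hX.indep (Fintype.card ι) (fun k => A (e.symm k)) (fun k => hA _)
      (fun j k hjk => hd (e.symm.injective.ne hjk))).precomp e.injective
    simpa using this
  rw [lintegral_prod_eq_prod_lintegral_of_indepFun Finset.univ _ hind
    fun j => measurable_countingMeasure hX.measurable (hA j)]
  exact Finset.prod_congr rfl fun j _ => hX.lintegral_count (hA j) (hΛ j)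

/-- The factorial moment measure of the point process `∑ᵢ δ_{X i}`. -/
noncomputable def factorialMoment (X : ℕ → Ω → E) (P : Measure Ω) (ι : Type*) :
    Measure (ι → E) :=
  Measure.sum fun e : ι ↪ ℕ => P.map fun ω j => X (e j) ω

lemma lintegral_factorialMoment (hX : ∀ i, Measurable (X i)) {ι : Type*} [Finite ι]
    {g : (ι → E) → ℝ≥0∞} (hg : Measurable g) :
    ∫⁻ x, g x ∂(factorialMoment X P ι) = ∫⁻ ω, ∑' e : ι ↪ ℕ, g (fun j => X (e j) ω) ∂P := by
  have hm : ∀ e : ι ↪ ℕ, Measurable fun ω j => X (e j) ω := fun e =>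
    measurable_pi_lambda _ fun j => hX _
  rw [factorialMoment, lintegral_sum_measure,
    lintegral_tsum (f := fun (e : ι ↪ ℕ) ω => g fun j => X (e j) ω)
      fun e => (hg.comp (hm e)).aemeasurable]
  exact tsum_congr fun e => lintegral_map hg (hm e)

/-- A product measure is determined by its values on boxes. Inside a box with pairwise disjoint
sides every smaller box also has disjoint sides, so the product formula for independent counts
applies. -/
lemma IsPoissonProcess.factorialMoment_restrict_pi (hX : IsPoissonProcess X Λ P) {ι : Type*}
    [Fintype ι] [SigmaFinite Λ] (C : ι → Set E) (hC : ∀ j, MeasurableSet (C j))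
    (hΛ : ∀ j, Λ (C j) ≠ ∞) (hd : Pairwise fun j k => Disjoint (C j) (C k)) :
    (factorialMoment X P ι).restrict (Set.univ.pi C)
      = (Measure.pi fun _ : ι => Λ).restrict (Set.univ.pi C) := by
  rw [Measure.restrict_pi_pi]
  refine (Measure.pi_eq fun s hs => ?_).symm
  rw [Measure.restrict_apply (MeasurableSet.univ_pi hs), ← Set.pi_inter_distrib]
  have hsm : ∀ j, MeasurableSet (s j ∩ C j) := fun j => (hs j).inter (hC j)
  simp_rw [Measure.restrict_apply (hs _)]
  rw [← hX.lintegral_tsum_embedding_prod (fun j => s j ∩ C j) hsm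
    (fun j => measure_ne_top_of_subset Set.inter_subset_right (hΛ j))
    (fun j k hjk => (hd hjk).mono Set.inter_subset_right Set.inter_subset_right),
    ← lintegral_indicator_one (MeasurableSet.univ_pi hsm), lintegral_factorialMoment hX.measurable
      (measurable_one.indicator (MeasurableSet.univ_pi hsm))]
  refine lintegral_congr fun ω => tsum_congr fun e => ?_
  classical
  by_cases h : ∀ j, X (e j) ω ∈ s j ∩ C j
  · rw [Set.indicator_of_mem (by simpa using h)]
    simp [Set.indicator_of_mem (h _)]
  · rw [Set.indicator_of_notMem (by simpa using h)]
    push Not at h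
    obtain ⟨j, hj⟩ := h
    exact (Finset.prod_eq_zero (Finset.mem_univ j) (by rw [Set.indicator_of_notMem hj])).symm

end Count

/-! ### Campbell's formula for tuples of distinct points -/

section Strip

variable {Ω S : Type*} [MeasurableSpace Ω] [MeasurableSpace S] {X : ℕ → Ω → ℝ × S} {lam : ℝ}
  {Θ : Measure S} [IsProbabilityMeasure Θ] {P : Measure Ω}

lemma intensity_strip (lam : ℝ) (Θ : Measure S) [IsProbabilityMeasure Θ] (I : Set ℝ) :
    (ENNReal.ofReal lam • (volume : Measure ℝ).prod Θ) (I ×ˢ Set.univ)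
      = ENNReal.ofReal lam * volume I := by
  simp [Measure.smul_apply, Measure.prod_prod]

/-- Cut the unit interval into `n` cells of length `1/n`. Each holds two points with probability at
most `(lam/n)²`, so by the union bound a collision has probability at most `lam²/n`, for every `n`.
-/
lemma measure_collision_Ico (hX : IsPoissonProcess X (ENNReal.ofReal lam • (volume : Measure ℝ).prod Θ) P)
    {i j : ℕ} (hij : i ≠ j) (m : ℤ) :
    P {ω | (X i ω).1 = (X j ω).1 ∧ (X i ω).1 ∈ Set.Ico (m : ℝ) (m + 1)} = 0 := by
  have key : ∀ n : ℕ, 0 < n →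
      P {ω | (X i ω).1 = (X j ω).1 ∧ (X i ω).1 ∈ Set.Ico (m : ℝ) (m + 1)}
        ≤ ENNReal.ofReal lam ^ 2 * ENNReal.ofReal (1 / n) := by
    intro n hn
    have hn' : (0 : ℝ) < n := by exact_mod_cast hn
    let A : ℕ → Set (ℝ × S) := fun k => Set.Ico (m + k / n : ℝ) (m + k / n + 1 / n) ×ˢ Set.univ
    have hA : ∀ k, MeasurableSet (A k) := fun k => measurableSet_Ico.prod MeasurableSet.univ
    have hvol : ∀ k, (ENNReal.ofReal lam • (volume : Measure ℝ).prod Θ) (A k)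
        = ENNReal.ofReal lam * ENNReal.ofReal (1 / n) := by
      intro k
      rw [intensity_strip, Real.volume_Ico]
      congr 2; ring
    have hsub : {ω | (X i ω).1 = (X j ω).1 ∧ (X i ω).1 ∈ Set.Ico (m : ℝ) (m + 1)}
        ⊆ ⋃ k ∈ Finset.range n, {ω | 2 ≤ countingMeasure X ω (A k)} := by
      rintro ω ⟨h1, h2, h3⟩
      have h0 : 0 ≤ ((X i ω).1 - m) * n := mul_nonneg (by linarith) hn'.le
      set k := ⌊((X i ω).1 - m) * n⌋₊ with hk
      have hk1 : (k : ℝ) ≤ ((X i ω).1 - m) * n := Nat.floor_le h0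
      have hk2 : ((X i ω).1 - m) * n < k + 1 := Nat.lt_floor_add_one _
      have hkn : k < n := by
        rw [hk, Nat.floor_lt h0]
        nlinarith
      have hmem : (X i ω).1 ∈ Set.Ico (m + k / n : ℝ) (m + k / n + 1 / n) := by
        constructor
        · rw [← le_sub_iff_add_le', div_le_iff₀ hn']; exact hk1
        · rw [add_assoc, ← add_div, ← sub_lt_iff_lt_add', lt_div_iff₀ hn']; exact hk2
      simp only [Set.mem_iUnion, Finset.mem_range, Set.mem_ofPred_eq]
      exact ⟨k, hkn, two_le_countingMeasure (hA k) hij ⟨hmem, trivial⟩ ⟨h1 ▸ hmem, trivial⟩⟩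
    refine (measure_mono hsub).trans ((measure_biUnion_finset_le _ _).trans ?_)
    calc _ ≤ ∑ k ∈ Finset.range n, (ENNReal.ofReal lam * ENNReal.ofReal (1 / n)) ^ 2 := by
          refine Finset.sum_le_sum fun k _ => ?_
          rw [← hvol k]
          refine hX.measure_two_le_count (hA k) ?_
          rw [hvol k]; exact ENNReal.mul_ne_top ENNReal.ofReal_ne_top ENNReal.ofReal_ne_top
      _ = ENNReal.ofReal lam ^ 2 * ENNReal.ofReal (1 / n) * (n * ENNReal.ofReal (1 / n)) := by
          rw [Finset.sum_const, Finset.card_range, nsmul_eq_mul]; ring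
      _ = _ := by
          rw [← ENNReal.ofReal_natCast n, ← ENNReal.ofReal_mul hn'.le, mul_one_div_cancel hn'.ne']
          simp
  have hlim : Tendsto (fun n : ℕ => ENNReal.ofReal lam ^ 2 * ENNReal.ofReal (1 / n)) atTop (𝓝 0) := by
    have h := ENNReal.tendsto_ofReal (tendsto_one_div_atTop_nhds_zero_nat (𝕜 := ℝ))
    rw [ENNReal.ofReal_zero] at h
    have := ENNReal.Tendsto.const_mul (a := ENNReal.ofReal lam ^ 2) h
      (Or.inr (ENNReal.pow_ne_top ENNReal.ofReal_ne_top))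
    simpa using this
  refine le_antisymm (ge_of_tendsto hlim ?_) zero_le
  filter_upwards [eventually_gt_atTop 0] with n hn using key n hn

lemma ae_injective_fst
    (hX : IsPoissonProcess X (ENNReal.ofReal lam • (volume : Measure ℝ).prod Θ) P) :
    ∀ᵐ ω ∂P, Function.Injective fun i => (X i ω).1 := by
  have h : ∀ᵐ ω ∂P, ∀ i j : ℕ, i ≠ j → ∀ m : ℤ,
      ¬ ((X i ω).1 = (X j ω).1 ∧ (X i ω).1 ∈ Set.Ico (m : ℝ) (m + 1)) := by
    simp only [ae_all_iff]
    intro i j hij m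
    rw [ae_iff]
    simpa only [not_not] using measure_collision_Ico hX hij m
  filter_upwards [h] with ω hω i j hij
  by_contra hne
  exact hω i j hne ⌊(X i ω).1⌋ ⟨hij, Int.floor_le _, Int.lt_floor_add_one _⟩

/-- By Fubini: once the other coordinates are fixed, coordinate `i` must hit a single prescribed
first component, which is a null event. -/
lemma ae_injective_fst_pi (Λ : Measure (ℝ × S)) [SigmaFinite Λ]
    (hΛ : ∀ p : ℝ, Λ {x | x.1 = p} = 0) {ι : Type*} [Fintype ι] :
    ∀ᵐ x ∂(Measure.pi fun _ : ι => Λ), Function.Injective fun i => (x i).1 := by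
  classical
  suffices h : ∀ᵐ x ∂(Measure.pi fun _ : ι => Λ), ∀ i j, i ≠ j → (x i).1 ≠ (x j).1 by
    filter_upwards [h] with x hx i j hij
    by_contra hne
    exact hx i j hne hij
  simp only [ae_all_iff]
  intro i j hij
  have hmp := measurePreserving_piEquivPiSubtypeProd (fun _ : ι => Λ) (fun k => k = i)
  let Z : Set (({k // k = i} → ℝ × S) × ({k // ¬ k = i} → ℝ × S)) :=
    {y | (y.1 ⟨i, rfl⟩).1 = (y.2 ⟨j, hij.symm⟩).1}
  have hZ : MeasurableSet Z := measurableSet_eq_fun (by fun_prop) (by fun_prop)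
  have h0 : ((Measure.pi fun _ : {k // k = i} => Λ).prod
      (Measure.pi fun _ : {k // ¬ k = i} => Λ)) Z = 0 := by
    rw [Measure.prod_apply_symm hZ]
    simp only [lintegral_eq_zero_iff (measurable_measure_prodMk_right hZ)]
    refine Eventually.of_forall fun y => ?_
    exact Measure.pi_eval_preimage_null (μ := fun _ : {k // k = i} => Λ) (i := ⟨i, rfl⟩)
      (hΛ (y ⟨j, hij.symm⟩).1)
  have h1 := hmp.measure_preimage hZ.nullMeasurableSet
  have h2 : (Measure.pi fun _ : ι => Λ)
      (MeasurableEquiv.piEquivPiSubtypeProd (fun _ => ℝ × S) (fun k => k = i) ⁻¹' Z) = 0 := by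
    rw [h1]; convert h0
  rw [ae_iff]
  simpa using! h2

/-- **Campbell's formula** for the factorial moment measures of a stationary Poisson hyperplane
process. -/
theorem factorialMoment_eq_pi
    (hX : IsPoissonProcess X (ENNReal.ofReal lam • (volume : Measure ℝ).prod Θ) P)
    {ι : Type*} [Fintype ι] :
    factorialMoment X P ι
      = Measure.pi fun _ : ι => ENNReal.ofReal lam • (volume : Measure ℝ).prod Θ := by
  have : SigmaFinite (ENNReal.ofReal lam • (volume : Measure ℝ).prod Θ) :=
    inferInstanceAs (SigmaFinite (lam.toNNReal • (volume : Measure ℝ).prod Θ))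
  set Λ := ENNReal.ofReal lam • (volume : Measure ℝ).prod Θ with hΛdef
  -- The boxes with pairwise disjoint rational strips as sides form a countable family, and on each
  -- of them the two measures agree. Their union `D` contains every tuple with distinct first
  -- components, so its complement is null for both measures.
  let I : ℚ × ℚ → Set (ℝ × S) := fun q => Set.Ioo (q.1 : ℝ) q.2 ×ˢ Set.univ
  let T := {c : ι → ℚ × ℚ // Pairwise fun j k => Disjoint (I (c j)) (I (c k))}
  let D : Set (ι → ℝ × S) := ⋃ c : T, Set.univ.pi fun j => I (c.1 j)
  have hI : ∀ q, MeasurableSet (I q) := fun q => measurableSet_Ioo.prod MeasurableSet.univ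
  have hD : MeasurableSet D := MeasurableSet.iUnion fun c => MeasurableSet.univ_pi fun j => hI _
  have hmemD : ∀ x : ι → ℝ × S, (Function.Injective fun i => (x i).1) → x ∈ D := by
    intro x hx
    obtain ⟨δ, hδ, hsep⟩ : ∃ δ > 0, ∀ i j, i ≠ j → 2 * δ ≤ |(x i).1 - (x j).1| := by
      have hfin := Set.toFinite {p : ι × ι | p.1 ≠ p.2}
      obtain ⟨δ, hδ, h⟩ : ∃ δ > 0, ∀ p ∈ {p : ι × ι | p.1 ≠ p.2},
          δ ≤ |(x p.1).1 - (x p.2).1| := by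
        rcases Set.eq_empty_or_nonempty {p : ι × ι | p.1 ≠ p.2} with he | hne
        -- With at most one index there are no pairs to separate, and any positive value serves.
        · exact ⟨1, one_pos, by simp [he]⟩
        · obtain ⟨p, hp, hmin⟩ := hfin.exists_minimalFor (fun p => |(x p.1).1 - (x p.2).1|) _ hne
          refine ⟨_, abs_pos.2 (sub_ne_zero.2 fun h => hp (hx h)), fun q hq => ?_⟩
          rcases le_total (|(x p.1).1 - (x p.2).1|) (|(x q.1).1 - (x q.2).1|) with h | h
          · exact h
          · exact hmin hq h
      exact ⟨δ / 2, by positivity, fun i j hij => by have := h (i, j) hij; simpa using by linarith⟩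
    choose a ha1 ha2 using fun i => exists_rat_btwn (show (x i).1 - δ < (x i).1 by linarith)
    choose b hb1 hb2 using fun i => exists_rat_btwn (show (x i).1 < (x i).1 + δ by linarith)
    refine Set.mem_iUnion.2 ⟨⟨fun i => (a i, b i), fun i j hij => ?_⟩, fun i _ => ?_⟩
    · refine Set.disjoint_left.2 ?_
      rintro ⟨p, v⟩ ⟨⟨h1, h2⟩, -⟩ ⟨⟨h3, h4⟩, -⟩
      have h5 := hsep i j hij
      have := ha1 i; have := ha1 j; have := hb2 i; have := hb2 j
      simp only at h1 h2 h3 h4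
      have : |(x i).1 - (x j).1| < 2 * δ := by rw [abs_lt]; constructor <;> linarith
      linarith
    · exact ⟨⟨ha2 i, hb1 i⟩, trivial⟩
  have hres : (factorialMoment X P ι).restrict D = (Measure.pi fun _ : ι => Λ).restrict D := by
    refine Measure.restrict_iUnion_congr.2 fun c => ?_
    refine hX.factorialMoment_restrict_pi _ (fun j => hI _) (fun j => ?_) c.2
    rw [intensity_strip, Real.volume_Ioo]
    exact ENNReal.mul_ne_top ENNReal.ofReal_ne_top ENNReal.ofReal_ne_top
  have h1 : (factorialMoment X P ι) Dᶜ = 0 := by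
    rw [← lintegral_indicator_one hD.compl, lintegral_factorialMoment hX.measurable
      (measurable_one.indicator hD.compl)]
    rw [lintegral_congr_ae (g := fun _ => 0), lintegral_zero]
    filter_upwards [ae_injective_fst hX] with ω hω
    rw [ENNReal.tsum_eq_zero]
    intro e
    rw [Set.indicator_of_notMem]
    rw [Set.mem_compl_iff, not_not]
    exact hmemD _ (hω.comp e.injective)
  have h2 : (Measure.pi fun _ : ι => Λ) Dᶜ = 0 := by
    have hΛ0 : ∀ p : ℝ, Λ {x | x.1 = p} = 0 := by
      intro p
      have : {x : ℝ × S | x.1 = p} = {p} ×ˢ Set.univ := by ext; simp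
      rw [this, hΛdef, intensity_strip]; simp
    refine measure_mono_null (fun x hx => ?_) (ae_injective_fst_pi Λ hΛ0 (ι := ι))
    exact fun h => hx (hmemD x h)
  rw [← Measure.restrict_add_restrict_compl (μ := factorialMoment X P ι) hD, hres,
    Measure.restrict_eq_zero.2 h1, ← Measure.restrict_eq_zero.2 h2,
    Measure.restrict_add_restrict_compl hD]

end Strip

/-! ### Product measures and the first marginal of a kernel -/

section PiMeasure

variable {E : Type*} [MeasurableSpace E] (μ : Measure E) [IsProbabilityMeasure μ]

lemma measurePreserving_sumElim {α β : Type*} [Fintype α] [Fintype β] :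
    MeasurePreserving (fun p : (α → E) × (β → E) => (Sum.elim p.1 p.2 : α ⊕ β → E))
      ((Measure.pi fun _ => μ).prod (Measure.pi fun _ => μ)) (Measure.pi fun _ => μ) := by
  have hm : Measurable fun p : (α → E) × (β → E) => (Sum.elim p.1 p.2 : α ⊕ β → E) := by
    refine measurable_pi_lambda _ fun k => ?_
    rcases k with k | k <;> simp only [Sum.elim_inl, Sum.elim_inr] <;> fun_prop
  refine ⟨hm, (Measure.pi_eq fun s hs => ?_).symm⟩
  rw [Measure.map_apply hm (MeasurableSet.univ_pi hs)]
  have : (fun p : (α → E) × (β → E) => (Sum.elim p.1 p.2 : α ⊕ β → E)) ⁻¹' Set.univ.pi s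
      = (Set.univ.pi fun a => s (Sum.inl a)) ×ˢ (Set.univ.pi fun b => s (Sum.inr b)) := by
    ext p; simp
  rw [this, Measure.prod_prod, Measure.pi_pi, Measure.pi_pi, Fintype.prod_sum_type]

lemma lintegral_pi_sum {α β : Type*} [Fintype α] [Fintype β] {F : (α ⊕ β → E) → ℝ≥0∞}
    (hF : Measurable F) :
    ∫⁻ x, F x ∂(Measure.pi fun _ => μ)
      = ∫⁻ y, ∫⁻ z, F (Sum.elim y z) ∂(Measure.pi fun _ => μ) ∂(Measure.pi fun _ => μ) := by
  rw [← (measurePreserving_sumElim μ).lintegral_comp hF,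
    lintegral_prod (fun p : (α → E) × (β → E) => F (Sum.elim p.1 p.2))
      (hF.comp (measurePreserving_sumElim μ).measurable).aemeasurable]

lemma measurePreserving_const {α : Type*} [Fintype α] [Unique α] :
    MeasurePreserving (fun (x : E) (_ : α) => x) μ (Measure.pi fun _ => μ) := by
  have hm : Measurable fun (x : E) (_ : α) => x := by fun_prop
  refine ⟨hm, (Measure.pi_eq fun s hs => ?_).symm⟩
  rw [Measure.map_apply hm (MeasurableSet.univ_pi hs)]
  have : (fun (x : E) (_ : α) => x) ⁻¹' Set.univ.pi s = s default := by
    ext x; simp [Unique.forall_iff]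
  rw [this, Fintype.prod_unique]

lemma measurePreserving_cons (n : ℕ) :
    MeasurePreserving (fun p : E × (Fin n → E) => (Fin.cons p.1 p.2 : Fin (n + 1) → E))
      (μ.prod (Measure.pi fun _ => μ)) (Measure.pi fun _ => μ) := by
  have hm : Measurable fun p : E × (Fin n → E) => (Fin.cons p.1 p.2 : Fin (n + 1) → E) := by
    refine measurable_pi_lambda _ fun k => ?_
    refine Fin.cases ?_ (fun k => ?_) k <;> simp only [Fin.cons_zero, Fin.cons_succ] <;> fun_prop
  refine ⟨hm, (Measure.pi_eq fun s hs => ?_).symm⟩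
  rw [Measure.map_apply hm (MeasurableSet.univ_pi hs)]
  have : (fun p : E × (Fin n → E) => (Fin.cons p.1 p.2 : Fin (n + 1) → E)) ⁻¹' Set.univ.pi s
      = (s 0) ×ˢ (Set.univ.pi fun b => s (Fin.succ b)) := by
    ext p; simp [Fin.forall_fin_succ]
  rw [this, Measure.prod_prod, Measure.pi_pi, Fin.prod_univ_succ]

lemma lintegral_pi_fin_succ {n : ℕ} {F : (Fin (n + 1) → E) → ℝ≥0∞} (hF : Measurable F) :
    ∫⁻ x, F x ∂(Measure.pi fun _ => μ)
      = ∫⁻ x, ∫⁻ y, F (Fin.cons x y) ∂(Measure.pi fun _ => μ) ∂μ := by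
  rw [← (measurePreserving_cons μ n).lintegral_comp hF,
    lintegral_prod (fun p : E × (Fin n → E) => F (Fin.cons p.1 p.2))
      (hF.comp (measurePreserving_cons μ n).measurable).aemeasurable]

lemma measurePreserving_comp_equiv {α β : Type*} [Fintype α] [Fintype β] (e : α ≃ β) :
    MeasurePreserving (fun x : β → E => x ∘ e) (Measure.pi fun _ => μ) (Measure.pi fun _ => μ) := by
  have hm : Measurable fun x : β → E => x ∘ e := by
    refine measurable_pi_lambda _ fun k => ?_
    simp only [Function.comp_apply]; fun_prop
  refine ⟨hm, (Measure.pi_eq fun s hs => ?_).symm⟩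
  rw [Measure.map_apply hm (MeasurableSet.univ_pi hs)]
  have : (fun x : β → E => x ∘ e) ⁻¹' Set.univ.pi s = Set.univ.pi fun b => s (e.symm b) := by
    ext x
    simp only [Set.mem_preimage, Set.mem_pi, Set.mem_univ, true_imp_iff, Function.comp_apply]
    exact ⟨fun h b => by simpa using h (e.symm b), fun h a => by simpa using h (e a)⟩
  rw [this, Measure.pi_pi, e.symm.prod_comp fun a => μ (s a)]

/-- The conditional expectation of a kernel given its first argument. -/
noncomputable def firstMarginal {n : ℕ} (g : (Fin (n + 1) → E) → ℝ≥0∞) (x : E) : ℝ≥0∞ :=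
  ∫⁻ y, g (Fin.cons x y) ∂(Measure.pi fun _ : Fin n => μ)

variable {n : ℕ} {g : (Fin (n + 1) → E) → ℝ≥0∞}

lemma measurable_firstMarginal (hg : Measurable g) : Measurable (firstMarginal μ g) :=
  Measurable.lintegral_prod_right' (hg.comp (measurePreserving_cons μ n).measurable)

lemma firstMarginal_le_one (h1 : ∀ x, g x ≤ 1) (x : E) : firstMarginal μ g x ≤ 1 := by
  refine (lintegral_mono fun y => h1 _).trans ?_
  simp

lemma lintegral_firstMarginal (hg : Measurable g) :
    ∫⁻ x, firstMarginal μ g x ∂μ = ∫⁻ x, g x ∂(Measure.pi fun _ => μ) :=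
  (lintegral_pi_fin_succ μ hg).symm

/-- A product of two kernel values sharing exactly one argument integrates to the second moment of
the first marginal. -/
lemma lintegral_mul_sharing_one (hg : Measurable g) :
    ∫⁻ x : Unit ⊕ (Fin n ⊕ Fin n) → E,
        g (Fin.cons (x (Sum.inl ())) fun k => x (Sum.inr (Sum.inl k))) *
          g (Fin.cons (x (Sum.inl ())) fun k => x (Sum.inr (Sum.inr k)))
        ∂(Measure.pi fun _ => μ)
      = ∫⁻ x, firstMarginal μ g x ^ 2 ∂μ := by
  have hc := (measurePreserving_cons μ n).measurable
  have hg' : Measurable fun p : E × (Fin n → E) => g (Fin.cons p.1 p.2) := hg.comp hc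
  have hF : Measurable fun x : Unit ⊕ (Fin n ⊕ Fin n) → E =>
      g (Fin.cons (x (Sum.inl ())) fun k => x (Sum.inr (Sum.inl k))) *
          g (Fin.cons (x (Sum.inl ())) fun k => x (Sum.inr (Sum.inr k))) := by
    refine (hg'.comp (Measurable.prodMk (by fun_prop) (by fun_prop))).mul
      (hg'.comp (Measurable.prodMk (by fun_prop) (by fun_prop)))
  rw [lintegral_pi_sum μ hF]
  simp only [Sum.elim_inl, Sum.elim_inr]
  have h2 : ∀ y : Unit → E, ∫⁻ z : Fin n ⊕ Fin n → E,
      g (Fin.cons (y ()) fun k => z (Sum.inl k)) * g (Fin.cons (y ()) fun k => z (Sum.inr k))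
        ∂(Measure.pi fun _ => μ) = firstMarginal μ g (y ()) ^ 2 := by
    intro y
    have hgy : Measurable fun z : Fin n → E => g (Fin.cons (y ()) z) :=
      hg'.comp measurable_prodMk_left
    rw [lintegral_pi_sum μ]
    · simp only [Sum.elim_inl, Sum.elim_inr]
      simp_rw [lintegral_const_mul _ hgy]
      rw [lintegral_mul_const _ hgy, sq]
      rfl
    · exact (hgy.comp (by fun_prop)).mul (hgy.comp (by fun_prop))
  simp_rw [h2]
  exact ((measurePreserving_const μ (α := Unit)).lintegral_comp
    (((measurable_firstMarginal μ hg).comp (measurable_pi_apply ())).pow_const 2)).symm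

end PiMeasure

/-! ### Sums over pairs of tuples and coincidence patterns -/

section Tsum

lemma tsum_indicator_le_tsum {α β : Type*} (T : Set α) (F : α → ℝ≥0∞) (G : β → ℝ≥0∞)
    (Φ : T → β) (hΦ : Function.Injective Φ) (h : ∀ p : T, F p ≤ G (Φ p)) :
    ∑' p, T.indicator F p ≤ ∑' q, G q := by
  rw [← tsum_subtype]
  exact (ENNReal.tsum_le_tsum h).trans (ENNReal.tsum_comp_le_tsum_of_injective hΦ G)

/-- Pairs of embeddings with disjoint ranges are embeddings of the disjoint union. -/
lemma tsum_disjoint_embedding {α β : Type*} (F : (α ↪ ℕ) → (β ↪ ℕ) → ℝ≥0∞) :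
    ∑' p : (α ↪ ℕ) × (β ↪ ℕ),
        {p : (α ↪ ℕ) × (β ↪ ℕ) | Disjoint (Set.range p.1) (Set.range p.2)}.indicator
          (fun p => F p.1 p.2) p
      = ∑' e : α ⊕ β ↪ ℕ,
        F (Function.Embedding.inl.trans e) (Function.Embedding.inr.trans e) := by
  rw [← tsum_subtype]
  exact (Equiv.tsum_eq Equiv.sumEmbeddingEquivProdEmbeddingDisjoint
    fun p : {p : (α ↪ ℕ) × (β ↪ ℕ) // Disjoint (Set.range p.1) (Set.range p.2)} =>
      F p.1.1 p.1.2).symm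

/-- Every map `φ` factors through the quotient by its kernel as an embedding. This sorts arbitrary
tuples by their pattern of coincidences and reduces them to tuples of distinct indices, where
Campbell's formula applies. -/
lemma tsum_pi_le_tsum_setoid {κ : Type*} (F : (κ → ℕ) → ℝ≥0∞) :
    ∑' φ, F φ ≤ ∑' (s : Setoid κ) (e : Quotient s ↪ ℕ), F fun k => e (Quotient.mk s k) := by
  rw [← ENNReal.tsum_sigma (fun (s : Setoid κ) (e : Quotient s ↪ ℕ) => F fun k => e (Quotient.mk s k))]
  let Φ : (κ → ℕ) → Σ s : Setoid κ, Quotient s ↪ ℕ := fun φ =>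
    ⟨Setoid.ker φ, ⟨Quotient.lift φ fun a b h => h, fun a b => by
      induction a using Quotient.inductionOn
      induction b using Quotient.inductionOn
      intro h
      exact Quotient.sound h⟩⟩
  have hval : ∀ φ k, (Φ φ).2 (Quotient.mk _ k) = φ k := fun φ k => rfl
  have hinj : Function.Injective Φ := by
    intro φ ψ h
    -- Quantifying over the whole pair `q` recovers `φ` from `Φ φ` without transport along an
    -- equality of setoids.
    have h2 : ∀ q : Σ s : Setoid κ, Quotient s ↪ ℕ, q = Φ φ →
        (fun k => q.2 (Quotient.mk _ k)) = φ := by rintro q rfl; rfl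
    exact ((h2 (Φ ψ) h.symm).symm.trans (funext fun k => hval ψ k))
  exact ENNReal.tsum_comp_le_tsum_of_injective hinj
    (fun q : Σ s : Setoid κ, Quotient s ↪ ℕ => F fun k => q.2 (Quotient.mk q.1 k))

end Tsum

/-! ### Campbell's formula on a strip of finite intensity -/

/-- On the set `A`, the factorial moment measures of `∑ᵢ δ_{X i}` are those of a Poisson process
with intensity measure `m • μ`. -/
def CampbellOn {Ω E : Type*} [MeasurableSpace Ω] [MeasurableSpace E] (X : ℕ → Ω → E)
    (P : Measure Ω) (A : Set E) (μ : Measure E) (m : ℝ≥0∞) : Prop :=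
  ∀ (ι : Type) [Fintype ι] (g : (ι → E) → ℝ≥0∞), Measurable g →
    (∀ x, (∃ j, x j ∉ A) → g x = 0) →
    ∫⁻ ω, ∑' e : ι ↪ ℕ, g (fun j => X (e j) ω) ∂P
      = m ^ Fintype.card ι * ∫⁻ x, g x ∂(Measure.pi fun _ => μ)

lemma volume_Icc_neg_self (r : ℝ) : volume (Set.Icc (-r) r) = ENNReal.ofReal (2 * r) := by
  rw [Real.volume_Icc]; congr 1; ring

lemma isProbabilityMeasure_cond_Icc {r : ℝ} (hr : 0 < r) :
    IsProbabilityMeasure (ProbabilityTheory.cond (volume : Measure ℝ) (Set.Icc (-r) r)) :=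
  cond_isProbabilityMeasure_of_finite (by rw [volume_Icc_neg_self]; simpa using hr)
    (by rw [volume_Icc_neg_self]; exact ENNReal.ofReal_ne_top)

lemma restrict_strip {S : Type*} [MeasurableSpace S] {lam : ℝ} (Θ : Measure S)
    [IsProbabilityMeasure Θ] (hlam : 0 < lam) {r : ℝ} (hr : 0 < r) :
    (ENNReal.ofReal lam • (volume : Measure ℝ).prod Θ).restrict (Set.Icc (-r) r ×ˢ Set.univ)
      = ENNReal.ofReal (2 * lam * r) •
        (ProbabilityTheory.cond (volume : Measure ℝ) (Set.Icc (-r) r)).prod Θ := by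
  rw [Measure.restrict_smul, ← Measure.prod_restrict, Measure.restrict_univ,
    ProbabilityTheory.cond, Measure.prod_smul_left, smul_smul, volume_Icc_neg_self]
  congr 1
  rw [show 2 * lam * r = lam * (2 * r) by ring, ENNReal.ofReal_mul hlam.le, mul_assoc,
    ENNReal.mul_inv_cancel (by simpa using hr) ENNReal.ofReal_ne_top, mul_one]

/-- For a kernel supported in the strip the intensity may be restricted to it, where it is `2 * lam
* r` times a probability measure. From here on the moment estimates see only this mass and this law.
-/
lemma campbellOn_strip {Ω S : Type*} [MeasurableSpace Ω] [MeasurableSpace S]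
    {X : ℕ → Ω → ℝ × S} {lam : ℝ} {Θ : Measure S} [IsProbabilityMeasure Θ] {P : Measure Ω}
    (hlam : 0 < lam)
    (hX : IsPoissonProcess X (ENNReal.ofReal lam • (volume : Measure ℝ).prod Θ) P)
    {r : ℝ} (hr : 0 < r) :
    CampbellOn X P (Set.Icc (-r) r ×ˢ Set.univ)
      ((ProbabilityTheory.cond (volume : Measure ℝ) (Set.Icc (-r) r)).prod Θ)
      (ENNReal.ofReal (2 * lam * r)) := by
  intro ι _ g hg hsupp
  have : SigmaFinite (ENNReal.ofReal lam • (volume : Measure ℝ).prod Θ) :=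
    inferInstanceAs (SigmaFinite (lam.toNNReal • (volume : Measure ℝ).prod Θ))
  have := isProbabilityMeasure_cond_Icc hr
  set A : Set (ℝ × S) := Set.Icc (-r) r ×ˢ Set.univ with hA
  set μ := (ProbabilityTheory.cond (volume : Measure ℝ) (Set.Icc (-r) r)).prod Θ with hμ
  have hpi : (Measure.pi fun _ : ι => ENNReal.ofReal lam • (volume : Measure ℝ).prod Θ).restrict
        (Set.univ.pi fun _ => A)
      = ENNReal.ofReal (2 * lam * r) ^ Fintype.card ι • Measure.pi fun _ : ι => μ := by
    rw [Measure.restrict_pi_pi]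
    refine Measure.pi_eq fun s hs => ?_
    simp only [hA, restrict_strip Θ hlam hr, Measure.smul_apply, smul_eq_mul, Measure.pi_pi,
      Finset.prod_mul_distrib, Finset.prod_const, Finset.card_univ, hμ]
  have hAm : MeasurableSet (Set.univ.pi fun _ : ι => A) :=
    MeasurableSet.univ_pi fun _ => measurableSet_Icc.prod MeasurableSet.univ
  have hind : (Set.univ.pi fun _ : ι => A).indicator g = g := by
    refine Set.indicator_eq_self.2 fun x hx => ?_
    rw [Set.mem_univ_pi]
    by_contra h
    push Not at h
    exact hx (hsupp x h)
  rw [← lintegral_factorialMoment hX.measurable hg, factorialMoment_eq_pi hX]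
  conv_lhs => rw [← hind]
  rw [lintegral_indicator hAm, hpi, lintegral_smul_measure, smul_eq_mul]

/-- The sum of a kernel over all tuples of distinct points. -/
noncomputable def uStat {Ω E ι : Type*} (X : ℕ → Ω → E) (g : (ι → E) → ℝ≥0∞) (ω : Ω) : ℝ≥0∞ :=
  ∑' e : ι ↪ ℕ, g fun j => X (e j) ω

lemma comp_swap_eq_cons {F : Type*} {n : ℕ} (f : Fin (n + 1) → F) (a : Fin (n + 1)) :
    f ∘ Equiv.swap 0 a = Fin.cons (f a) fun k => f (Equiv.swap 0 a k.succ) := by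
  funext k
  refine Fin.cases ?_ (fun k => ?_) k <;> simp

/-- Brings a chosen argument of a symmetric kernel to the front, so that an argument shared by two
tuples can always be taken to be the first one of each. -/
lemma kernel_eq_cons {E : Type*} {n : ℕ} {g : (Fin (n + 1) → E) → ℝ≥0∞}
    (hsymm : ∀ (σ : Equiv.Perm (Fin (n + 1))) x, g (x ∘ σ) = g x)
    (x : Fin (n + 1) → E) (a : Fin (n + 1)) :
    g x = g (Fin.cons (x a) fun k => x (Equiv.swap 0 a k.succ)) := by
  rw [← comp_swap_eq_cons, hsymm]

/-! ### Moments of U-statistics and of their linear parts -/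

section Moments

variable {Ω E : Type*} [MeasurableSpace Ω] [MeasurableSpace E] {X : ℕ → Ω → E} {P : Measure Ω}
  {A : Set E} {μ : Measure E} [IsProbabilityMeasure μ] {m : ℝ≥0∞}

lemma measurable_uStat (hX : ∀ i, Measurable (X i)) {ι : Type*} [Finite ι]
    {g : (ι → E) → ℝ≥0∞} (hg : Measurable g) : Measurable (uStat X g) :=
  Measurable.tsum fun e => hg.comp (measurable_pi_lambda _ fun j => hX (e j))

/-- The product is a sum over pairs of tuples. Pairs without a common index form one longer tuple of
distinct indices; the pairs with a common index are kept as a remainder. -/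
lemma uStat_mul_uStat {Ω E α β : Type*} (X : ℕ → Ω → E) (g : (α → E) → ℝ≥0∞)
    (h : (β → E) → ℝ≥0∞) (ω : Ω) :
    uStat X g ω * uStat X h ω
      = uStat X (fun x : α ⊕ β → E => g (x ∘ Sum.inl) * h (x ∘ Sum.inr)) ω
        + ∑' p : (α ↪ ℕ) × (β ↪ ℕ),
          {p : (α ↪ ℕ) × (β ↪ ℕ) | Disjoint (Set.range p.1) (Set.range p.2)}ᶜ.indicator
            (fun p => g (fun j => X (p.1 j) ω) * h (fun j => X (p.2 j) ω)) p := by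
  have h1 : uStat X g ω * uStat X h ω = ∑' p : (α ↪ ℕ) × (β ↪ ℕ),
      g (fun j => X (p.1 j) ω) * h (fun j => X (p.2 j) ω) := by
    rw [ENNReal.tsum_prod', uStat, ← ENNReal.tsum_mul_right]
    exact tsum_congr fun i => ENNReal.tsum_mul_left.symm
  have h2 : uStat X (fun x : α ⊕ β → E => g (x ∘ Sum.inl) * h (x ∘ Sum.inr)) ω = _ :=
    (tsum_disjoint_embedding fun (i : α ↪ ℕ) (j : β ↪ ℕ) =>
      g (fun k => X (i k) ω) * h (fun k => X (j k) ω)).symm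
  rw [h1, h2, ← ENNReal.tsum_add]
  refine tsum_congr fun p => ?_
  exact (Set.indicator_self_add_compl_apply _ (fun p : (α ↪ ℕ) × (β ↪ ℕ) =>
    g (fun j => X (p.1 j) ω) * h (fun j => X (p.2 j) ω)) p).symm

lemma lintegral_uStat_sum (hC : CampbellOn X P A μ m) {α β : Type} [Fintype α] [Fintype β]
    {g : (α → E) → ℝ≥0∞} {h : (β → E) → ℝ≥0∞} (hg : Measurable g) (hh : Measurable h)
    (hgA : ∀ x, (∃ j, x j ∉ A) → g x = 0) (hhA : ∀ x, (∃ j, x j ∉ A) → h x = 0) :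
    ∫⁻ ω, uStat X (fun x : α ⊕ β → E => g (x ∘ Sum.inl) * h (x ∘ Sum.inr)) ω ∂P
      = m ^ (Fintype.card α + Fintype.card β) *
        ((∫⁻ x, g x ∂(Measure.pi fun _ => μ)) * ∫⁻ x, h x ∂(Measure.pi fun _ => μ)) := by
  have hm : Measurable fun x : α ⊕ β → E => g (x ∘ Sum.inl) * h (x ∘ Sum.inr) := by
    refine (hg.comp ?_).mul (hh.comp ?_) <;>
      exact measurable_pi_lambda _ fun k => measurable_pi_apply _
  simp only [uStat]
  rw [hC _ _ hm, Fintype.card_sum, lintegral_pi_sum μ hm]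
  · congr 1
    simp only [Sum.elim_comp_inl, Sum.elim_comp_inr]
    simp_rw [lintegral_const_mul _ hh]
    rw [lintegral_mul_const _ hg]
  · rintro x ⟨j | j, hj⟩
    · simp [hgA (x ∘ Sum.inl) ⟨j, hj⟩]
    · simp [hhA (x ∘ Sum.inr) ⟨j, hj⟩]

lemma lintegral_unit (H : E → ℝ≥0∞) (hH : Measurable H) :
    ∫⁻ x, H (x ()) ∂(Measure.pi fun _ : Unit => μ) = ∫⁻ x, H x ∂μ :=
  ((measurePreserving_const μ (α := Unit)).lintegral_comp (hH.comp (measurable_pi_apply ()))).symm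

lemma lintegral_linear (hC : CampbellOn X P A μ m) {H : E → ℝ≥0∞} (hH : Measurable H)
    (hHA : ∀ x, x ∉ A → H x = 0) :
    ∫⁻ ω, uStat X (fun x : Unit → E => H (x ())) ω ∂P = m * ∫⁻ x, H x ∂μ := by
  simp only [uStat]
  rw [hC Unit (fun x => H (x ())) (hH.comp (measurable_pi_apply _))
    (by rintro x ⟨j, hj⟩; exact hHA _ hj), Fintype.card_unit, pow_one, lintegral_unit H hH]

/-- Off-diagonal pairs give the squared mean and the diagonal gives the variance. An upper bound
suffices, because this moment enters the squared error with a positive sign. -/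
lemma lintegral_linear_sq_le (hX : ∀ i, Measurable (X i)) (hC : CampbellOn X P A μ m)
    {H : E → ℝ≥0∞} (hH : Measurable H) (hHA : ∀ x, x ∉ A → H x = 0) :
    ∫⁻ ω, uStat X (fun x : Unit → E => H (x ())) ω ^ 2 ∂P
      ≤ m ^ 2 * (∫⁻ x, H x ∂μ) ^ 2 + m * ∫⁻ x, H x ^ 2 ∂μ := by
  have hHm : Measurable fun x : Unit → E => H (x ()) := hH.comp (measurable_pi_apply _)
  have hHA' : ∀ x : Unit → E, (∃ j, x j ∉ A) → H (x ()) = 0 := by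
    rintro x ⟨j, hj⟩; exact hHA _ hj
  have hpt : ∀ ω, uStat X (fun x : Unit → E => H (x ())) ω ^ 2
      ≤ uStat X (fun x : Unit ⊕ Unit → E => H ((x ∘ Sum.inl) ()) * H ((x ∘ Sum.inr) ())) ω
        + uStat X (fun x : Unit → E => H (x ()) ^ 2) ω := by
    intro ω
    rw [sq, uStat_mul_uStat X (fun x : Unit → E => H (x ())) (fun x : Unit → E => H (x ())) ω]
    gcongr
    have key : ∀ p : ({p : (Unit ↪ ℕ) × (Unit ↪ ℕ) |
        Disjoint (Set.range p.1) (Set.range p.2)}ᶜ : Set _), p.1.2 = p.1.1 := by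
      rintro ⟨⟨i, j⟩, hp⟩
      ext ⟨⟩
      by_contra hne
      refine hp (Set.disjoint_left.2 ?_)
      rintro _ ⟨⟨⟩, rfl⟩ ⟨⟨⟩, h⟩
      exact hne h
    refine tsum_indicator_le_tsum _ _ _ (fun p => p.1.1) ?_ ?_
    · intro p q h
      refine Subtype.ext (Prod.ext h ?_)
      rw [key p, key q]; exact h
    · intro p
      rw [key p]
      exact (sq _).ge
  refine (lintegral_mono hpt).trans ?_
  rw [lintegral_add_right _ (measurable_uStat hX (by fun_prop)),
    lintegral_uStat_sum hC hHm hHm hHA' hHA', lintegral_unit H hH,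
    lintegral_linear hC (hH.pow_const 2) (fun x hx => by simp [hHA x hx])]
  simp only [Fintype.card_unit]
  rw [← sq, one_add_one_eq_two]

section Kernel

variable {n : ℕ} {g : (Fin (n + 1) → E) → ℝ≥0∞}

lemma firstMarginal_eq_zero (hgA : ∀ x, (∃ j, x j ∉ A) → g x = 0) {x : E} (hx : x ∉ A) :
    firstMarginal μ g x = 0 := by
  refine (lintegral_congr fun y => hgA _ ⟨0, by simpa using hx⟩).trans ?_
  simp

/-- By symmetry `a` may be taken to be `0`; integrating out the remaining arguments of `g` then
produces a second factor of the first marginal. -/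
lemma lintegral_kernel_mul_firstMarginal (hg : Measurable g)
    (hsymm : ∀ (σ : Equiv.Perm (Fin (n + 1))) x, g (x ∘ σ) = g x) (a : Fin (n + 1)) :
    ∫⁻ x, g x * firstMarginal μ g (x a) ∂(Measure.pi fun _ => μ)
      = ∫⁻ x, firstMarginal μ g x ^ 2 ∂μ := by
  have hH := measurable_firstMarginal μ hg
  have hF : ∀ b : Fin (n + 1), Measurable fun x : Fin (n + 1) → E =>
      g x * firstMarginal μ g (x b) := fun b => hg.mul (hH.comp (measurable_pi_apply b))
  have h0 : ∫⁻ x, g x * firstMarginal μ g (x a) ∂(Measure.pi fun _ => μ)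
      = ∫⁻ x, g x * firstMarginal μ g (x 0) ∂(Measure.pi fun _ => μ) := by
    rw [← (measurePreserving_comp_equiv μ (Equiv.swap 0 a)).lintegral_comp (hF a)]
    simp [hsymm]
  rw [h0, lintegral_pi_fin_succ μ (hF 0)]
  simp only [Fin.cons_zero]
  refine lintegral_congr fun x => ?_
  have hgx : Measurable fun y : Fin n → E => g (Fin.cons x y) :=
    (hg.comp (measurePreserving_cons μ n).measurable).comp measurable_prodMk_left
  rw [lintegral_mul_const _ hgx, sq]
  rfl

/-- A point of `L` either lies outside the tuple of `W` or is one of its `n + 1` entries, which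
yields the two terms. A lower bound suffices, because the mixed moment enters the squared error with
a negative sign. -/
lemma le_lintegral_uStat_mul_linear (hX : ∀ i, Measurable (X i)) (hC : CampbellOn X P A μ m)
    (hg : Measurable g) (hgA : ∀ x, (∃ j, x j ∉ A) → g x = 0)
    (hsymm : ∀ (σ : Equiv.Perm (Fin (n + 1))) x, g (x ∘ σ) = g x) :
    m ^ (n + 2) * (∫⁻ x, g x ∂(Measure.pi fun _ => μ)) ^ 2
        + (n + 1) * m ^ (n + 1) * ∫⁻ x, firstMarginal μ g x ^ 2 ∂μ
      ≤ ∫⁻ ω, uStat X g ω * uStat X (fun x : Unit → E => firstMarginal μ g (x ())) ω ∂P := by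
  set H := firstMarginal μ g with hHdef
  have hH : Measurable H := measurable_firstMarginal μ hg
  have hHA : ∀ x, x ∉ A → H x = 0 := fun x hx => firstMarginal_eq_zero hgA hx
  have hHm : Measurable fun x : Unit → E => H (x ()) := hH.comp (measurable_pi_apply _)
  have hHA' : ∀ x : Unit → E, (∃ j, x j ∉ A) → H (x ()) = 0 := by
    rintro x ⟨j, hj⟩; exact hHA _ hj
  have hpt : ∀ ω, uStat X (fun x : Fin (n + 1) ⊕ Unit → E =>
        g (x ∘ Sum.inl) * H ((x ∘ Sum.inr) ())) ω
        + uStat X (fun x : Fin (n + 1) → E => ∑ a, g x * H (x a)) ω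
      ≤ uStat X g ω * uStat X (fun x : Unit → E => H (x ())) ω := by
    intro ω
    rw [uStat_mul_uStat X g (fun x : Unit → E => H (x ())) ω]
    gcongr
    have h1 : uStat X (fun x : Fin (n + 1) → E => ∑ a, g x * H (x a)) ω
        = ∑' q : (Fin (n + 1) ↪ ℕ) × Fin (n + 1),
          g (fun j => X (q.1 j) ω) * H (X (q.1 q.2) ω) := by
      rw [ENNReal.tsum_prod']
      exact tsum_congr fun e => (tsum_fintype _).symm
    rw [h1]
    -- A tuple with a marked entry is sent to the tuple together with the index of that entry; such
    -- pairs overlap by construction.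
    let Ψ : (Fin (n + 1) ↪ ℕ) × Fin (n + 1) → (Fin (n + 1) ↪ ℕ) × (Unit ↪ ℕ) :=
      fun q => (q.1, ⟨fun _ => q.1 q.2, fun _ _ _ => rfl⟩)
    have hΨ : Function.Injective Ψ := by
      rintro ⟨i, a⟩ ⟨j, b⟩ h
      obtain ⟨h1, h2⟩ := Prod.ext_iff.1 h
      have h1 : i = j := h1
      subst h1
      have h3 : i a = i b := congrArg (fun e : Unit ↪ ℕ => e ()) h2
      rw [i.injective h3]
    refine le_trans (le_of_eq (tsum_congr fun q => ?_))
      (ENNReal.tsum_comp_le_tsum_of_injective hΨ _)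
    rw [Set.indicator_of_mem]
    · rfl
    · intro hd
      exact Set.disjoint_left.1 hd ⟨q.2, rfl⟩ ⟨(), rfl⟩
  refine le_trans (le_of_eq ?_) (lintegral_mono hpt)
  have hgH : ∀ a, Measurable fun x : Fin (n + 1) → E => g x * H (x a) :=
    fun a => hg.mul (hH.comp (measurable_pi_apply a))
  have hsum : Measurable fun x : Fin (n + 1) → E => ∑ a, g x * H (x a) :=
    Finset.measurable_sum _ fun a _ => hgH a
  rw [lintegral_add_right _ (measurable_uStat hX hsum),
    lintegral_uStat_sum hC hg hHm hgA hHA', lintegral_unit H hH, lintegral_firstMarginal μ hg]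
  simp only [uStat]
  rw [hC _ _ hsum (fun x hx => by simp [hgA x hx]), lintegral_finsetSum _
    fun a _ => hgH a]
  rw [Finset.sum_congr rfl fun a _ => (lintegral_kernel_mul_firstMarginal hg hsymm a :
    ∫⁻ x, g x * H (x a) ∂(Measure.pi fun _ => μ) = ∫⁻ x, H x ^ 2 ∂μ)]
  simp only [Fintype.card_fin, Fintype.card_unit, Finset.sum_const, Finset.card_univ,
    nsmul_eq_mul, Nat.cast_add, Nat.cast_one]
  ring

end Kernel

end Moments

/-! ### Pairs of tuples with one or with at least two common points -/

section Overlap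

variable {Ω E : Type*} {X : ℕ → Ω → E} {A : Set E} {n : ℕ} {g : (Fin (n + 1) → E) → ℝ≥0∞}

/-- The indices of a pair of `(n+1)`-tuples that share the entries `b` and `b'` of the second. -/
abbrev OverlapIndex (b b' : Fin (n + 1)) : Type := Fin (n + 1) ⊕ {k : Fin (n + 1) // k ≠ b ∧ k ≠ b'}

lemma card_overlapIndex {b b' : Fin (n + 1)} (h : b ≠ b') :
    Fintype.card (OverlapIndex b b') = 2 * n := by
  have h1 : Fintype.card {k : Fin (n + 1) // k ≠ b ∧ k ≠ b'} = n + 1 - 2 := by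
    rw [Fintype.card_subtype]
    have : (Finset.univ.filter fun k : Fin (n + 1) => k ≠ b ∧ k ≠ b') = {b, b'}ᶜ := by
      ext k; simp
    rw [this, Finset.card_compl, Finset.card_pair h, Fintype.card_fin]
  rw [Fintype.card_sum, h1, Fintype.card_fin]
  have : b.1 ≠ b'.1 := fun h' => h (Fin.ext h')
  omega

/-- The constant in the bound for the contribution of the pairs of tuples sharing two entries. -/
noncomputable def overlapConst (n : ℕ) : ℕ :=
  ∑ b : Fin (n + 1), ∑ b' : Fin (n + 1), ∑ _a : Fin (n + 1), ∑ _a' : Fin (n + 1),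
    Nat.card (Setoid (OverlapIndex b b'))

/-- Such a pair is determined by its first tuple and by the entries of the second other than `b` and
`b'`. The product of kernels is at most the indicator that all these points lie in `A`, so only the
number of free indices, `2 * n` when `b ≠ b'`, will matter. -/
lemma tsum_overlap_two_le (h1 : ∀ x, g x ≤ 1) (hgA : ∀ x, (∃ j, x j ∉ A) → g x = 0)
    (a a' b b' : Fin (n + 1)) (ω : Ω) :
    ∑' p : (Fin (n + 1) ↪ ℕ) × (Fin (n + 1) ↪ ℕ),
        {p : (Fin (n + 1) ↪ ℕ) × (Fin (n + 1) ↪ ℕ) | p.1 a = p.2 b ∧ p.1 a' = p.2 b'}.indicator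
          (fun p => g (fun k => X (p.1 k) ω) * g (fun k => X (p.2 k) ω)) p
      ≤ ∑' φ : OverlapIndex b b' → ℕ, ∏ k, A.indicator 1 (X (φ k) ω) := by
  refine tsum_indicator_le_tsum _ _ _
    (fun p => Sum.elim p.1.1 fun k => p.1.2 k.1) ?_ ?_
  · rintro ⟨⟨i, j⟩, h⟩ ⟨⟨i', j'⟩, h'⟩ heq
    have hi : i = i' := by
      ext k; exact congrFun heq (Sum.inl k)
    subst hi
    have hj : j = j' := by
      ext k
      by_cases hb : k = b
      · rw [hb]; exact h.1.symm.trans h'.1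
      by_cases hb' : k = b'
      · rw [hb']; exact h.2.symm.trans h'.2
      exact congrFun heq (Sum.inr ⟨k, hb, hb'⟩)
    subst hj
    rfl
  · rintro ⟨⟨i, j⟩, h⟩
    by_cases hall : (∀ k, X (i k) ω ∈ A) ∧ ∀ k, X (j k) ω ∈ A
    · refine (mul_le_one' (h1 _) (h1 _)).trans (le_of_eq ?_)
      symm
      refine Finset.prod_eq_one fun k _ => ?_
      rcases k with k | k
      · simp [hall.1 k]
      · simp [hall.2 k.1]
    · rw [not_and_or] at hall
      rcases hall with hn | hn <;> push Not at hn
      · simp [hgA (fun k => X (i k) ω) hn]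
      · simp [hgA (fun k => X (j k) ω) hn]

/-- With exactly one coincidence the pair consists of `2 * n + 1` distinct indices: the shared one
and `n` private ones for each tuple. Symmetry of `g` lets the shared one be placed first in both. -/
lemma tsum_overlap_one_le (hsymm : ∀ (σ : Equiv.Perm (Fin (n + 1))) x, g (x ∘ σ) = g x)
    (a b : Fin (n + 1)) (ω : Ω) :
    ∑' p : (Fin (n + 1) ↪ ℕ) × (Fin (n + 1) ↪ ℕ),
        {p : (Fin (n + 1) ↪ ℕ) × (Fin (n + 1) ↪ ℕ) | p.1 a = p.2 b ∧
            ∀ a' b', p.1 a' = p.2 b' → a' = a ∧ b' = b}.indicator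
          (fun p => g (fun k => X (p.1 k) ω) * g (fun k => X (p.2 k) ω)) p
      ≤ uStat X (fun x : Unit ⊕ (Fin n ⊕ Fin n) → E =>
        g (Fin.cons (x (Sum.inl ())) fun k => x (Sum.inr (Sum.inl k))) *
          g (Fin.cons (x (Sum.inl ())) fun k => x (Sum.inr (Sum.inr k)))) ω := by
  have hne : ∀ (c : Fin (n + 1)) (k : Fin n), Equiv.swap 0 c k.succ ≠ c := by
    intro c k h
    have := (Equiv.swap_apply_eq_iff).1 h
    rw [Equiv.swap_apply_right] at this
    exact Fin.succ_ne_zero k this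
  have hinj : ∀ (c : Fin (n + 1)) (k l : Fin n),
      Equiv.swap 0 c k.succ = Equiv.swap 0 c l.succ → k = l := fun c k l h =>
    Fin.succ_injective _ ((Equiv.swap 0 c).injective h)
  have hsurj : ∀ c k : Fin (n + 1), k = c ∨ ∃ l : Fin n, k = Equiv.swap 0 c l.succ := by
    intro c k
    rcases Fin.eq_zero_or_eq_succ (Equiv.swap 0 c k) with h | ⟨l, hl⟩
    · left
      have := (Equiv.swap_apply_eq_iff).1 h
      rwa [Equiv.swap_apply_left] at this
    · right
      exact ⟨l, (Equiv.swap_apply_eq_iff).1 hl⟩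
  let T : Set ((Fin (n + 1) ↪ ℕ) × (Fin (n + 1) ↪ ℕ)) := {p | p.1 a = p.2 b ∧
            ∀ a' b', p.1 a' = p.2 b' → a' = a ∧ b' = b}
  let φ : (Fin (n + 1) ↪ ℕ) × (Fin (n + 1) ↪ ℕ) → Unit ⊕ (Fin n ⊕ Fin n) → ℕ := fun p =>
    Sum.elim (fun _ => p.1 a) (Sum.elim (fun k => p.1 (Equiv.swap 0 a k.succ))
      fun k => p.2 (Equiv.swap 0 b k.succ))
  have hφ : ∀ p ∈ T, Function.Injective (φ p) := by
    rintro ⟨i, j⟩ ⟨h1, h2⟩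
    rintro (⟨⟩ | k | k) (⟨⟩ | l | l) h <;> simp only [φ, Sum.elim_inl, Sum.elim_inr] at h
    · rfl
    · exact absurd (i.injective h).symm (hne a l)
    · exact absurd (h2 _ _ h).2 (hne b l)
    · exact absurd (i.injective h) (hne a k)
    · rw [hinj a k l (i.injective h)]
    · exact absurd (h2 _ _ h).1 (hne a k)
    · exact absurd (h2 _ _ h.symm).2 (hne b k)
    · exact absurd (h2 _ _ h.symm).1 (hne a l)
    · rw [hinj b k l (j.injective h)]
  refine tsum_indicator_le_tsum _ _ _ (fun p : T => ⟨φ p.1, hφ p.1 p.2⟩) ?_ ?_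
  · rintro ⟨⟨i, j⟩, h⟩ ⟨⟨i', j'⟩, h'⟩ heq
    have heq' : φ (i, j) = φ (i', j') := congrArg (fun e : _ ↪ ℕ => (e : _ → ℕ)) heq
    have h0 : i a = i' a := congrFun heq' (Sum.inl ())
    have hi : i = i' := by
      ext k
      rcases hsurj a k with rfl | ⟨l, rfl⟩
      · exact h0
      · exact congrFun heq' (Sum.inr (Sum.inl l))
    have hj : j = j' := by
      ext k
      rcases hsurj b k with rfl | ⟨l, rfl⟩
      · exact h.1.symm.trans (h0.trans h'.1)
      · exact congrFun heq' (Sum.inr (Sum.inr l))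
    subst hi; subst hj; rfl
  · rintro ⟨⟨i, j⟩, h⟩
    have hb : i a = j b := h.1
    refine le_of_eq ?_
    change g _ * g _ = g (Fin.cons (X (i a) ω) fun k => X (i (Equiv.swap 0 a k.succ)) ω) *
      g (Fin.cons (X (i a) ω) fun k => X (j (Equiv.swap 0 b k.succ)) ω)
    rw [kernel_eq_cons hsymm (fun k => X (i k) ω) a, kernel_eq_cons hsymm (fun k => X (j k) ω) b,
      hb]

end Overlap

/-! ### The second moment of a U-statistic -/

section SecondMoment

variable {Ω E : Type*} [MeasurableSpace Ω] [MeasurableSpace E] {X : ℕ → Ω → E} {P : Measure Ω}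
  {A : Set E} {μ : Measure E} [IsProbabilityMeasure μ] {m : ℝ≥0∞}

/-- A bound for the moments of the number of points in `A`. -/
lemma lintegral_tsum_pi_le (hX : ∀ i, Measurable (X i)) (hC : CampbellOn X P A μ m)
    (hA : MeasurableSet A) (hm : 1 ≤ m) (κ : Type) [Fintype κ] :
    ∫⁻ ω, ∑' φ : κ → ℕ, ∏ k, A.indicator 1 (X (φ k) ω) ∂P
      ≤ Nat.card (Setoid κ) * m ^ Fintype.card κ := by
  have : Finite (Setoid κ) := Finite.of_injective (fun s : Setoid κ => s.r) fun s t h =>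
    Setoid.ext fun a b => by rw [← Setoid.comm', ← Setoid.comm' t]; exact iff_of_eq (congrFun₂ h b a)
  have := Fintype.ofFinite (Setoid κ)
  have hG : ∀ s : Setoid κ, Measurable fun x : Quotient s → E =>
      ∏ k, A.indicator (1 : E → ℝ≥0∞) (x (Quotient.mk s k)) := fun s =>
    Finset.measurable_prod _ fun k _ => (measurable_one.indicator hA).comp (measurable_pi_apply _)
  refine (lintegral_mono fun ω => tsum_pi_le_tsum_setoid
    fun φ : κ → ℕ => ∏ k, A.indicator (1 : E → ℝ≥0∞) (X (φ k) ω)).trans ?_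
  simp only [tsum_fintype]
  have hU : ∀ s : Setoid κ, Measurable fun ω => ∑' e : Quotient s ↪ ℕ,
      ∏ k, A.indicator (1 : E → ℝ≥0∞) (X (e (Quotient.mk s k)) ω) := fun s =>
    measurable_uStat hX (hG s)
  rw [lintegral_finsetSum _ fun s _ => hU s, Nat.card_eq_fintype_card]
  rw [← nsmul_eq_mul, ← Finset.card_univ]
  refine Finset.sum_le_card_nsmul _ _ _ fun s _ => ?_
  have := Fintype.ofFinite (Quotient s)
  rw [hC (Quotient s) _ (hG s)]
  -- A pattern has at most as many classes as `κ` has elements, and `1 ≤ m`, so each pattern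
  -- contributes at most the top power.
  · calc _ ≤ m ^ Fintype.card κ * 1 := by
          gcongr
          · exact Fintype.card_le_of_surjective _ Quotient.mk_surjective
          · refine (lintegral_mono fun x => ?_).trans (by simp : ∫⁻ _, 1 ∂_ ≤ 1)
            exact Finset.prod_le_one' fun k _ => Set.indicator_le_self' (by simp) _
      _ = _ := mul_one _
  · rintro x ⟨q, hq⟩
    obtain ⟨k, rfl⟩ := Quotient.mk_surjective q
    exact Finset.prod_eq_zero (Finset.mem_univ k) (by simp [hq])

variable {n : ℕ} {g : (Fin (n + 1) → E) → ℝ≥0∞}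

/-- The three terms come from pairs of tuples with no, exactly one, and at least two common indices.
The last class is bounded crudely, since it has lower order in `m`. -/
lemma lintegral_uStat_sq_le (hX : ∀ i, Measurable (X i)) (hC : CampbellOn X P A μ m)
    (hA : MeasurableSet A) (hm : 1 ≤ m) (hg : Measurable g) (h1 : ∀ x, g x ≤ 1)
    (hgA : ∀ x, (∃ j, x j ∉ A) → g x = 0)
    (hsymm : ∀ (σ : Equiv.Perm (Fin (n + 1))) x, g (x ∘ σ) = g x) :
    ∫⁻ ω, uStat X g ω ^ 2 ∂P
      ≤ m ^ (2 * n + 2) * (∫⁻ x, g x ∂(Measure.pi fun _ => μ)) ^ 2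
        + (n + 1) ^ 2 * m ^ (2 * n + 1) * ∫⁻ x, firstMarginal μ g x ^ 2 ∂μ
        + overlapConst n * m ^ (2 * n) := by
  set k2 : (Unit ⊕ (Fin n ⊕ Fin n) → E) → ℝ≥0∞ := fun x =>
    g (Fin.cons (x (Sum.inl ())) fun k => x (Sum.inr (Sum.inl k))) *
      g (Fin.cons (x (Sum.inl ())) fun k => x (Sum.inr (Sum.inr k))) with hk2
  have hg' : Measurable fun p : E × (Fin n → E) => g (Fin.cons p.1 p.2) :=
    hg.comp (measurePreserving_cons μ n).measurable
  have hk2m : Measurable k2 :=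
    (hg'.comp (Measurable.prodMk (by fun_prop) (by fun_prop))).mul
      (hg'.comp (Measurable.prodMk (by fun_prop) (by fun_prop)))
  have hk2A : ∀ x, (∃ j, x j ∉ A) → k2 x = 0 := by
    rintro x ⟨⟨⟩ | k | k, hk⟩
    · simp only [hk2]; rw [hgA _ ⟨0, by simpa using hk⟩, zero_mul]
    · simp only [hk2]; rw [hgA _ ⟨k.succ, by simpa using hk⟩, zero_mul]
    · simp only [hk2]
      rw [hgA (Fin.cons (x (Sum.inl ())) fun k => x (Sum.inr (Sum.inr k)))
        ⟨k.succ, by simpa using hk⟩, mul_zero]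
  -- The value `0` on the diagonal reflects that two different coincidences always involve different
  -- entries of the second tuple.
  let R : Fin (n + 1) → Fin (n + 1) → Ω → ℝ≥0∞ := fun b b' ω =>
    if b = b' then 0 else ∑' φ : OverlapIndex b b' → ℕ, ∏ k, A.indicator 1 (X (φ k) ω)
  have hRm : ∀ b b', Measurable (R b b') := by
    intro b b'
    simp only [R]
    split_ifs
    · exact measurable_const
    · exact Measurable.tsum fun φ => Finset.measurable_prod _ fun k _ =>
        (measurable_one.indicator hA).comp (hX _)
  have hpt : ∀ ω, uStat X g ω ^ 2
      ≤ uStat X (fun x : Fin (n + 1) ⊕ Fin (n + 1) → E => g (x ∘ Sum.inl) * g (x ∘ Sum.inr)) ω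
        + (∑ _a : Fin (n + 1), ∑ _b : Fin (n + 1), uStat X k2 ω)
        + ∑ b, ∑ b', ∑ _a : Fin (n + 1), ∑ _a' : Fin (n + 1), R b b' ω := by
    intro ω
    rw [sq, uStat_mul_uStat X g g ω, add_assoc]
    gcongr
    let F : (Fin (n + 1) ↪ ℕ) × (Fin (n + 1) ↪ ℕ) → ℝ≥0∞ := fun p =>
      g (fun k => X (p.1 k) ω) * g (fun k => X (p.2 k) ω)
    let T1 : Fin (n + 1) → Fin (n + 1) → Set ((Fin (n + 1) ↪ ℕ) × (Fin (n + 1) ↪ ℕ)) := fun a b =>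
      {p | p.1 a = p.2 b ∧ ∀ a' b', p.1 a' = p.2 b' → a' = a ∧ b' = b}
    let T2 : Fin (n + 1) → Fin (n + 1) → Fin (n + 1) → Fin (n + 1) →
      Set ((Fin (n + 1) ↪ ℕ) × (Fin (n + 1) ↪ ℕ)) := fun b b' a a' =>
      {p | b ≠ b' ∧ p.1 a = p.2 b ∧ p.1 a' = p.2 b'}
    -- An overlapping pair has a coincidence `(a, b)`. Either it is the only one, or there is
    -- another `(a', b')`, and then injectivity of the first tuple forces `b ≠ b'`.
    have hcover : ∀ p, {p : (Fin (n + 1) ↪ ℕ) × (Fin (n + 1) ↪ ℕ) |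
          Disjoint (Set.range p.1) (Set.range p.2)}ᶜ.indicator F p
        ≤ (∑ a, ∑ b, (T1 a b).indicator F p)
          + ∑ b, ∑ b', ∑ a, ∑ a', (T2 b b' a a').indicator F p := by
      intro p
      by_cases hd : Disjoint (Set.range p.1) (Set.range p.2)
      · rw [Set.indicator_of_notMem (by simpa using hd)]; exact zero_le
      rw [Set.indicator_of_mem (by simpa using hd)]
      obtain ⟨_, ⟨a, rfl⟩, ⟨b, hab⟩⟩ := Set.not_disjoint_iff.1 hd
      by_cases hu : ∀ a' b', p.1 a' = p.2 b' → a' = a ∧ b' = b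
      · refine le_trans ?_ le_self_add
        refine le_trans ?_ (Finset.single_le_sum_of_canonicallyOrdered (Finset.mem_univ a))
        refine le_trans ?_ (Finset.single_le_sum_of_canonicallyOrdered (Finset.mem_univ b))
        rw [Set.indicator_of_mem (show p ∈ T1 a b from ⟨hab.symm, hu⟩)]
      · push Not at hu
        obtain ⟨a', b', h', hne⟩ := hu
        have hbb : b ≠ b' := by
          rintro rfl
          exact hne (p.1.injective (h'.trans hab)) rfl
        refine le_trans ?_ le_add_self
        refine le_trans ?_ (Finset.single_le_sum_of_canonicallyOrdered (Finset.mem_univ b))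
        refine le_trans ?_ (Finset.single_le_sum_of_canonicallyOrdered (Finset.mem_univ b'))
        refine le_trans ?_ (Finset.single_le_sum_of_canonicallyOrdered (Finset.mem_univ a))
        refine le_trans ?_ (Finset.single_le_sum_of_canonicallyOrdered (Finset.mem_univ a'))
        rw [Set.indicator_of_mem (show p ∈ T2 b b' a a' from ⟨hbb, hab.symm, h'⟩)]
    refine (ENNReal.tsum_le_tsum hcover).trans ?_
    rw [ENNReal.tsum_add]
    simp_rw [Summable.tsum_finsetSum (fun _ _ => ENNReal.summable)]
    gcongr with a _ b _ b _ b' _ a _ a' _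
    · exact tsum_overlap_one_le hsymm a b ω
    · by_cases hbb : b = b'
      · refine le_of_eq_of_le (ENNReal.tsum_eq_zero.2 fun p => ?_) zero_le
        exact Set.indicator_of_notMem (fun h => h.1 hbb) _
      · simp only [R, if_neg hbb]
        refine le_trans (le_of_eq ?_) (tsum_overlap_two_le h1 hgA a a' b b' ω)
        simp only [T2, hbb, ne_eq, not_false_eq_true, true_and, F]
  refine (lintegral_mono hpt).trans ?_
  have hmk2 := measurable_uStat hX hk2m
  have hR4 : Measurable fun ω => ∑ b, ∑ b', ∑ _a : Fin (n + 1), ∑ _a' : Fin (n + 1), R b b' ω := by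
    fun_prop
  have hS2 : Measurable fun ω => ∑ _a : Fin (n + 1), ∑ _b : Fin (n + 1), uStat X k2 ω := by
    fun_prop
  rw [lintegral_add_right _ hR4, lintegral_add_right _ hS2, lintegral_uStat_sum hC hg hg hgA hgA]
  have hk2int : ∫⁻ ω, uStat X k2 ω ∂P
      = m ^ (2 * n + 1) * ∫⁻ x, firstMarginal μ g x ^ 2 ∂μ := by
    simp only [uStat]
    rw [hC _ k2 hk2m hk2A, lintegral_mul_sharing_one μ hg]
    simp only [Fintype.card_sum, Fintype.card_unit, Fintype.card_fin]
    congr 2; ring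
  have hRint : ∀ b b', ∫⁻ ω, R b b' ω ∂P
      ≤ Nat.card (Setoid (OverlapIndex b b')) * m ^ (2 * n) := by
    intro b b'
    by_cases hbb : b = b'
    · simp [R, hbb]
    · simp only [R, if_neg hbb]
      have := lintegral_tsum_pi_le hX hC hA hm (OverlapIndex b b')
      rwa [card_overlapIndex hbb] at this
  gcongr ?_ + ?_ + ?_
  · rw [Fintype.card_fin, ← sq, show n + 1 + (n + 1) = 2 * n + 2 by ring]
  · simp only [Finset.sum_const, Finset.card_univ, Fintype.card_fin, nsmul_eq_mul]
    rw [lintegral_const_mul _ (by fun_prop), lintegral_const_mul _ hmk2, hk2int]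
    refine le_of_eq ?_
    push_cast; ring
  · rw [overlapConst]
    push_cast
    simp_rw [Finset.sum_mul]
    rw [lintegral_finsetSum _ (by fun_prop)]
    gcongr with b
    rw [lintegral_finsetSum _ (by fun_prop)]
    gcongr with b'
    rw [lintegral_finsetSum _ (by fun_prop)]
    gcongr with a
    rw [lintegral_finsetSum _ (by fun_prop)]
    gcongr with a'
    exact hRint b b'

end SecondMoment

/-! ### The mean square distance between a U-statistic and its linear part -/

section Real

variable {Ω : Type*} [MeasurableSpace Ω] {P : Measure Ω}

lemma memLp_two_toReal {f : Ω → ℝ≥0∞} (hf : Measurable f) (h : ∫⁻ ω, f ω ^ 2 ∂P ≠ ∞) :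
    MemLp (fun ω => (f ω).toReal) 2 P := by
  rw [memLp_two_iff_integrable_sq hf.ennreal_toReal.aestronglyMeasurable]
  simp_rw [← ENNReal.toReal_pow]
  exact integrable_toReal_of_lintegral_ne_top (hf.pow_const 2).aemeasurable h

lemma ae_ne_top_of_lintegral_sq {f : Ω → ℝ≥0∞} (hf : Measurable f)
    (h : ∫⁻ ω, f ω ^ 2 ∂P ≠ ∞) : ∀ᵐ ω ∂P, f ω ≠ ∞ := by
  filter_upwards [ae_lt_top (hf.pow_const 2) h] with ω hω hf'
  simp [hf'] at hω

lemma toReal_lintegral {f : Ω → ℝ≥0∞} (hf : Measurable f) (h : ∀ᵐ ω ∂P, f ω ≠ ∞) :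
    ∫ ω, (f ω).toReal ∂P = (∫⁻ ω, f ω ∂P).toReal :=
  integral_toReal hf.aemeasurable (by filter_upwards [h] with ω hω using hω.lt_top)

/-- Expansion of the second moment of the difference of two affine functions. -/
lemma integral_sub_affine_sq [IsProbabilityMeasure P] {W L : Ω → ℝ} (hW : MemLp W 2 P) (hL : MemLp L 2 P) (a b c : ℝ) :
    ∫ ω, (W ω - a - b * (L ω - c)) ^ 2 ∂P
      = (∫ ω, W ω ^ 2 ∂P) + b ^ 2 * (∫ ω, L ω ^ 2 ∂P) - 2 * b * (∫ ω, W ω * L ω ∂P)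
        + 2 * (b * c - a) * (∫ ω, W ω ∂P) - 2 * b * (b * c - a) * (∫ ω, L ω ∂P)
        + (b * c - a) ^ 2 := by
  have hW1 : Integrable W P := hW.integrable one_le_two
  have hL1 : Integrable L P := hL.integrable one_le_two
  have hW2 : Integrable (fun ω => W ω ^ 2) P := hW.integrable_sq
  have hL2 : Integrable (fun ω => L ω ^ 2) P := hL.integrable_sq
  have hWL : Integrable (fun ω => W ω * L ω) P := hW.integrable_mul hL
  have h : ∀ ω, (W ω - a - b * (L ω - c)) ^ 2 = W ω ^ 2 + b ^ 2 * L ω ^ 2 - 2 * b * (W ω * L ω)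
      + 2 * (b * c - a) * W ω - 2 * b * (b * c - a) * L ω + (b * c - a) ^ 2 := fun ω => by ring
  simp_rw [h]
  have i1 := hL2.const_mul (b ^ 2)
  have i2 := hWL.const_mul (2 * b)
  have i3 := hW1.const_mul (2 * (b * c - a))
  have i4 := hL1.const_mul (2 * b * (b * c - a))
  have j1 : Integrable (fun ω => W ω ^ 2 + b ^ 2 * L ω ^ 2) P := hW2.add i1
  have j2 : Integrable (fun ω => W ω ^ 2 + b ^ 2 * L ω ^ 2 - 2 * b * (W ω * L ω)) P := j1.sub i2
  have j3 : Integrable (fun ω => W ω ^ 2 + b ^ 2 * L ω ^ 2 - 2 * b * (W ω * L ω)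
      + 2 * (b * c - a) * W ω) P := j2.add i3
  have j4 : Integrable (fun ω => W ω ^ 2 + b ^ 2 * L ω ^ 2 - 2 * b * (W ω * L ω)
      + 2 * (b * c - a) * W ω - 2 * b * (b * c - a) * L ω) P := j3.sub i4
  rw [integral_add j4 (integrable_const _), integral_sub j3 i4, integral_add j2 i3,
    integral_sub j1 i2, integral_add hW2 i1]
  simp only [integral_const_mul, integral_const, probReal_univ, one_smul]

end Real

section Linearization

variable {Ω E : Type*} [MeasurableSpace Ω] [MeasurableSpace E] {X : ℕ → Ω → E} {P : Measure Ω}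
  [IsProbabilityMeasure P] {A : Set E} {μ : Measure E} [IsProbabilityMeasure μ]

variable {n : ℕ} {g : (Fin (n + 1) → E) → ℝ≥0∞} {m : ℝ}

lemma lintegral_le_one_of_le_one {F : Type*} [MeasurableSpace F] (ν : Measure F)
    [IsProbabilityMeasure ν] {f : F → ℝ≥0∞} (h : ∀ x, f x ≤ 1) : ∫⁻ x, f x ∂ν ≤ 1 :=
  (lintegral_mono h).trans (by simp)

/-- The U-statistic differs from its linear part by an error of smaller order. -/
lemma integral_linearization_sq_le (hX : ∀ i, Measurable (X i))
    (hC : CampbellOn X P A μ (ENNReal.ofReal m))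
    (hA : MeasurableSet A) (hm : 1 ≤ m) (hg : Measurable g) (h1 : ∀ x, g x ≤ 1)
    (hgA : ∀ x, (∃ j, x j ∉ A) → g x = 0)
    (hsymm : ∀ (σ : Equiv.Perm (Fin (n + 1))) x, g (x ∘ σ) = g x) :
    (∀ᵐ ω ∂P, uStat X g ω ≠ ∞) ∧
    MemLp (fun ω => (uStat X g ω).toReal) 2 P ∧
    MemLp (fun ω => (uStat X (fun x : Unit → E => firstMarginal μ g (x ())) ω).toReal) 2 P ∧
    ∫ ω, ((uStat X g ω).toReal
        - m ^ (n + 1) * (∫⁻ x, g x ∂(Measure.pi fun _ => μ)).toReal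
        - (n + 1) * m ^ n *
          ((uStat X (fun x : Unit → E => firstMarginal μ g (x ())) ω).toReal
            - m * (∫⁻ x, g x ∂(Measure.pi fun _ => μ)).toReal)) ^ 2 ∂P
      ≤ overlapConst n * m ^ (2 * n) := by
  have hm0 : 0 ≤ m := by linarith
  set H := firstMarginal μ g with hHdef
  have hH : Measurable H := measurable_firstMarginal μ hg
  have hH1 : ∀ x, H x ≤ 1 := firstMarginal_le_one μ h1
  have hHA : ∀ x, x ∉ A → H x = 0 := fun x hx => firstMarginal_eq_zero hgA hx
  have hHm : Measurable fun x : Unit → E => H (x ()) := hH.comp (measurable_pi_apply _)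
  set θ := ∫⁻ x, g x ∂(Measure.pi fun _ => μ) with hθ
  set S := ∫⁻ x, H x ^ 2 ∂μ with hS
  have hθt : θ ≠ ∞ := ((lintegral_le_one_of_le_one _ h1).trans_lt ENNReal.one_lt_top).ne
  have hSt : S ≠ ∞ := ((lintegral_le_one_of_le_one _ fun x => pow_le_one' (hH1 x) 2).trans_lt
    ENNReal.one_lt_top).ne
  have hHθ : ∫⁻ x, H x ∂μ = θ := lintegral_firstMarginal μ hg
  have hmpow : ∀ k, ENNReal.ofReal m ^ k ≠ ∞ := fun k => ENNReal.pow_ne_top ENNReal.ofReal_ne_top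
  have hWm : Measurable (uStat X g) := measurable_uStat hX hg
  have hLm : Measurable (uStat X fun x : Unit → E => H (x ())) := measurable_uStat hX hHm
  set W := uStat X g
  set L := uStat X fun x : Unit → E => H (x ())
  have hW2 := lintegral_uStat_sq_le hX hC hA (by simpa using hm) hg h1 hgA hsymm
  have hW2t : ENNReal.ofReal m ^ (2 * n + 2) * θ ^ 2
      + (n + 1) ^ 2 * ENNReal.ofReal m ^ (2 * n + 1) * S
        + overlapConst n * ENNReal.ofReal m ^ (2 * n) ≠ ∞ := by finiteness
  have hL2 := lintegral_linear_sq_le hX hC hH hHA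
  rw [hHθ] at hL2
  have hL2t : ENNReal.ofReal m ^ 2 * θ ^ 2 + ENNReal.ofReal m * S ≠ ∞ := by finiteness
  have hWL := le_lintegral_uStat_mul_linear hX hC hg hgA hsymm
  have hWLp := memLp_two_toReal hWm (ne_top_of_le_ne_top hW2t hW2)
  have hLLp := memLp_two_toReal hLm (ne_top_of_le_ne_top hL2t hL2)
  have hWfin := ae_ne_top_of_lintegral_sq hWm (ne_top_of_le_ne_top hW2t hW2)
  have hLfin := ae_ne_top_of_lintegral_sq hLm (ne_top_of_le_ne_top hL2t hL2)
  refine ⟨hWfin, hWLp, hLLp, ?_⟩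
  rw [integral_sub_affine_sq hWLp hLLp]
  have eW : ∫ ω, (W ω).toReal ∂P = m ^ (n + 1) * θ.toReal := by
    rw [toReal_lintegral hWm hWfin]
    have : ∫⁻ ω, W ω ∂P = ENNReal.ofReal m ^ (n + 1) * θ := by
      have := hC _ g hg hgA
      rwa [Fintype.card_fin] at this
    rw [this, ENNReal.toReal_mul, ENNReal.toReal_pow, ENNReal.toReal_ofReal hm0]
  have eL : ∫ ω, (L ω).toReal ∂P = m * θ.toReal := by
    rw [toReal_lintegral hLm hLfin, lintegral_linear hC hH hHA, hHθ, ENNReal.toReal_mul,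
      ENNReal.toReal_ofReal hm0]
  have eW2 : ∫ ω, (W ω).toReal ^ 2 ∂P ≤ m ^ (2 * n + 2) * θ.toReal ^ 2
      + (n + 1) ^ 2 * m ^ (2 * n + 1) * S.toReal + overlapConst n * m ^ (2 * n) := by
    simp_rw [← ENNReal.toReal_pow]
    rw [toReal_lintegral (hWm.pow_const 2) (by
      filter_upwards [hWfin] with ω hω using ENNReal.pow_ne_top hω)]
    refine (ENNReal.toReal_mono hW2t hW2).trans (le_of_eq ?_)
    rw [ENNReal.toReal_add (by finiteness) (by finiteness),
      ENNReal.toReal_add (by finiteness) (by finiteness)]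
    simp [ENNReal.toReal_ofReal hm0, ENNReal.toReal_add]
  have eL2 : ∫ ω, (L ω).toReal ^ 2 ∂P ≤ m ^ 2 * θ.toReal ^ 2 + m * S.toReal := by
    simp_rw [← ENNReal.toReal_pow]
    rw [toReal_lintegral (hLm.pow_const 2) (by
      filter_upwards [hLfin] with ω hω using ENNReal.pow_ne_top hω)]
    refine (ENNReal.toReal_mono hL2t hL2).trans (le_of_eq ?_)
    rw [ENNReal.toReal_add (by finiteness) (by finiteness)]
    simp [ENNReal.toReal_ofReal hm0]
  have eWL : m ^ (n + 2) * θ.toReal ^ 2 + (n + 1) * m ^ (n + 1) * S.toReal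
      ≤ ∫ ω, (W ω).toReal * (L ω).toReal ∂P := by
    have hint : Integrable (fun ω => (W ω).toReal * (L ω).toReal) P := hWLp.integrable_mul hLLp
    simp_rw [← ENNReal.toReal_mul] at hint ⊢
    have hfin : ∀ᵐ ω ∂P, W ω * L ω ≠ ∞ := by
      filter_upwards [hWfin, hLfin] with ω h1 h2 using ENNReal.mul_ne_top h1 h2
    have hmul : Measurable fun ω => W ω * L ω := hWm.mul hLm
    rw [toReal_lintegral hmul hfin]
    have htop : ∫⁻ ω, W ω * L ω ∂P ≠ ∞ := by
      have := hint.lintegral_lt_top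
      refine ne_top_of_le_ne_top this.ne (lintegral_mono_ae ?_)
      filter_upwards [hfin] with ω hω
      rw [ENNReal.ofReal_toReal hω]
    refine le_trans (le_of_eq ?_) (ENNReal.toReal_mono htop hWL)
    rw [ENNReal.toReal_add (by finiteness) (by finiteness)]
    simp [ENNReal.toReal_ofReal hm0, ENNReal.toReal_add]
    rfl
  rw [eW, eL]
  set t := θ.toReal
  set s := S.toReal
  have hb : (0 : ℝ) ≤ (n + 1) * m ^ n := by positivity
  have e1 := mul_le_mul_of_nonneg_left eL2 (sq_nonneg ((n + 1 : ℝ) * m ^ n))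
  have e2 := mul_le_mul_of_nonneg_left eWL (mul_nonneg zero_le_two hb)
  -- With the exact means and the three second moment bounds inserted, all terms in `t²` and in `s`
  -- cancel identically; only the contribution of pairs with at least two common points survives.
  refine (by linarith : _ ≤ (m ^ (2 * n + 2) * t ^ 2
      + (n + 1) ^ 2 * m ^ (2 * n + 1) * s + overlapConst n * m ^ (2 * n))
      + ((n + 1 : ℝ) * m ^ n) ^ 2 * (m ^ 2 * t ^ 2 + m * s)
      - 2 * ((n + 1) * m ^ n) * (m ^ (n + 2) * t ^ 2 + (n + 1) * m ^ (n + 1) * s)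
      + 2 * ((n + 1) * m ^ n * (m * t) - m ^ (n + 1) * t) * (m ^ (n + 1) * t)
      - 2 * ((n + 1) * m ^ n) * ((n + 1) * m ^ n * (m * t) - m ^ (n + 1) * t) * (m * t)
      + ((n + 1) * m ^ n * (m * t) - m ^ (n + 1) * t) ^ 2).trans (le_of_eq ?_)
  ring

end Linearization

/-! ### The characteristic function of a Poisson integral -/

section CharFun

variable {Ω E : Type*} [MeasurableSpace Ω] [MeasurableSpace E] {X : ℕ → Ω → E} {Λ : Measure E}
  {P : Measure Ω}

/-- Reading the linear statistic as an integral makes dominated convergence available for each fixed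
`ω`. -/
lemma uStat_unit {Ω E : Type*} [MeasurableSpace E] (X : ℕ → Ω → E) {H : E → ℝ≥0∞}
    (hH : Measurable H) (ω : Ω) :
    uStat X (fun x : Unit → E => H (x ())) ω = ∫⁻ x, H x ∂(countingMeasure X ω) := by
  rw [countingMeasure, lintegral_sum_measure, uStat,
    ← (Equiv.uniqueEmbeddingEquivResult (α := Unit) (β := ℕ)).symm.tsum_eq]
  refine tsum_congr fun i => ?_
  rw [lintegral_dirac' _ hH]
  rfl

lemma IsPoissonProcess.map_count_toReal (hX : IsPoissonProcess X Λ P) {A : Set E}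
    (hA : MeasurableSet A) (hΛ : Λ A ≠ ∞) :
    P.map (fun ω => (countingMeasure X ω A).toReal)
      = (poissonMeasure (Λ A).toNNReal).map (fun n : ℕ => (n : ℝ)) := by
  have h := (hX.hasLaw_count A hA hΛ).map_eq
  have h2 := congrArg (Measure.map ENNReal.toReal) h
  rw [Measure.map_map ENNReal.measurable_toReal (measurable_countingMeasure hX.measurable hA),
    Measure.map_map ENNReal.measurable_toReal (by fun_prop)] at h2
  simpa [Function.comp_def] using! h2

lemma IsPoissonProcess.charFun_mul_count (hX : IsPoissonProcess X Λ P) {A : Set E}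
    (hA : MeasurableSet A) (hΛ : Λ A ≠ ∞) (c t : ℝ) :
    charFun (P.map (fun ω => c * (countingMeasure X ω A).toReal)) t
      = Complex.exp ((Λ A).toReal * (Complex.exp (t * c * Complex.I) - 1)) := by
  rw [charFun_map_mul_comp
    (measurable_countingMeasure hX.measurable hA).ennreal_toReal.aemeasurable,
    hX.map_count_toReal hA hΛ, charFun_map_cast_poissonMeasure]
  simp only [ENNReal.coe_toNNReal_eq_toReal, Complex.ofReal_mul, mul_comm (t : ℂ)]

/-- The part of `A` where the function `h` has integer part `l` after multiplication by `k`. -/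
def levelCell {E : Type*} (A : Set E) (h : E → ℝ) (k l : ℕ) : Set E :=
  A ∩ {x | ⌊k * h x⌋₊ = l}

variable {A : Set E} {h : E → ℝ}

lemma measurable_floor_mul (hh : Measurable h) (k : ℕ) : Measurable fun x => ⌊k * h x⌋₊ :=
  Nat.measurable_floor.comp (hh.const_mul _)

lemma measurableSet_levelCell (hA : MeasurableSet A) (hh : Measurable h) (k l : ℕ) :
    MeasurableSet (levelCell A h k l) :=
  hA.inter (measurable_floor_mul hh k (measurableSet_singleton l))

lemma disjoint_levelCell {E : Type*} (A : Set E) (h : E → ℝ) (k : ℕ) {l l' : ℕ} (hl : l ≠ l') :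
    Disjoint (levelCell A h k l) (levelCell A h k l') :=
  Set.disjoint_left.2 fun _ h1 h2 => hl (h1.2.symm.trans h2.2)

/-- Since `h ≤ 1`, the integer part of `k * h` takes only the values `0, …, k`. The formula serves
both for the random counting measure and for the intensity measure. -/
lemma setIntegral_comp_floor (hA : MeasurableSet A) (hh : Measurable h)
    (h1 : ∀ x, h x ≤ 1) {ν : Measure E} (hν : ν A ≠ ∞) {G : Type*} [NormedAddCommGroup G]
    [NormedSpace ℝ G] [CompleteSpace G] (F : ℕ → G) (k : ℕ) :
    ∫ x in A, F ⌊k * h x⌋₊ ∂ν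
      = ∑ l : Fin (k + 1), (ν (levelCell A h k l)).toReal • F l := by
  have hU : A = ⋃ l : Fin (k + 1), levelCell A h k l := by
    ext x
    simp only [levelCell, Set.mem_iUnion, Set.mem_inter_iff, Set.mem_ofPred_eq]
    refine ⟨fun hx => ⟨⟨⌊k * h x⌋₊, ?_⟩, hx, rfl⟩, fun ⟨_, hx, _⟩ => hx⟩
    rw [Nat.lt_succ_iff]
    refine Nat.floor_le_of_le ?_
    exact mul_le_of_le_one_right (Nat.cast_nonneg k) (h1 x)
  have heq : ∀ l : Fin (k + 1), ∀ x ∈ levelCell A h k l, F ⌊k * h x⌋₊ = F l := fun l x hx => by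
    rw [hx.2]
  have hfin : ∀ l : Fin (k + 1), ν (levelCell A h k l) ≠ ∞ := fun l =>
    measure_ne_top_of_subset Set.inter_subset_left hν
  conv_lhs => rw [hU]
  rw [integral_iUnion_fintype (s := fun l : Fin (k + 1) => levelCell A h k l)
    (fun l => measurableSet_levelCell hA hh k l)
    (fun l l' hl => disjoint_levelCell A h k (fun h' => hl (Fin.ext h')))]
  · refine Finset.sum_congr rfl fun l _ => ?_
    rw [setIntegral_congr_fun (measurableSet_levelCell hA hh k l) (heq l), setIntegral_const]
    rfl
  · intro l
    refine IntegrableOn.congr_fun (f := fun _ => F l) ?_ (fun x hx => (heq l x hx).symm)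
      (measurableSet_levelCell hA hh k l)
    exact integrableOn_const (hfin l)

lemma tendsto_floor_mul_div {x : ℝ} (hx : 0 ≤ x) :
    Tendsto (fun k : ℕ => (⌊k * x⌋₊ : ℝ) / k) atTop (𝓝 x) := by
  have := (tendsto_nat_floor_mul_div_atTop hx).comp (tendsto_natCast_atTop_atTop (R := ℝ))
  simpa [Function.comp_def, mul_comm] using this

lemma floor_mul_div_le_one {x : ℝ} (hx : x ≤ 1) (k : ℕ) : (⌊k * x⌋₊ : ℝ) / k ≤ 1 := by
  refine div_le_one_of_le₀ ?_ (Nat.cast_nonneg k)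
  exact_mod_cast Nat.floor_le_of_le (mul_le_of_le_one_right (Nat.cast_nonneg k) hx)

/-- The characteristic function of a Poisson integral. -/
lemma IsPoissonProcess.charFun_linear [IsProbabilityMeasure P] (hX : IsPoissonProcess X Λ P)
    (hA : MeasurableSet A) (hΛ : Λ A ≠ ∞) {H : E → ℝ≥0∞} (hH : Measurable H) (hH1 : ∀ x, H x ≤ 1)
    (hHA : ∀ x, x ∉ A → H x = 0) (t : ℝ) :
    charFun (P.map fun ω => (uStat X (fun x : Unit → E => H (x ())) ω).toReal) t
      = Complex.exp (∫ x in A, (Complex.exp (t * (H x).toReal * Complex.I) - 1) ∂Λ) := by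
  set h : E → ℝ := fun x => (H x).toReal with hh
  have hhm : Measurable h := hH.ennreal_toReal
  have hh0 : ∀ x, 0 ≤ h x := fun x => ENNReal.toReal_nonneg
  have hh1 : ∀ x, h x ≤ 1 := fun x => ENNReal.toReal_le_of_le_ofReal zero_le_one (by simpa using hH1 x)
  have hLm : Measurable fun ω => uStat X (fun x : Unit → E => H (x ())) ω :=
    measurable_uStat hX.measurable (hH.comp (measurable_pi_apply ()))
  have hNfin : ∀ᵐ ω ∂P, countingMeasure X ω A ≠ ∞ := by
    have := ae_lt_top (measurable_countingMeasure hX.measurable hA)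
      (by rw [hX.lintegral_count hA hΛ]; exact hΛ)
    filter_upwards [this] with ω hω using hω.ne
  have hLint : ∀ ω, countingMeasure X ω A ≠ ∞ →
      (uStat X (fun x : Unit → E => H (x ())) ω).toReal
        = ∫ x in A, h x ∂(countingMeasure X ω) := by
    intro ω hω
    rw [uStat_unit X hH, hh, integral_toReal hH.aemeasurable
      (Eventually.of_forall fun x => (hH1 x).trans_lt ENNReal.one_lt_top),
      ← lintegral_indicator hA, Set.indicator_eq_self.2 fun x hx => by
        by_contra h'; exact hx (hHA x h')]
  -- The linear statistic of `h` rounded down to multiples of `1/k`: a finite combination of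
  -- independent Poisson counts, so its characteristic function is explicit.
  let D : ℕ → Ω → ℝ := fun k ω => ∑ l : Fin (k + 1),
    ((l : ℕ) / k : ℝ) * (countingMeasure X ω (levelCell A h k l)).toReal
  have hDm : ∀ k, Measurable (D k) := fun k => Finset.measurable_sum _ fun l _ =>
    ((measurable_countingMeasure hX.measurable
      (measurableSet_levelCell hA hhm k l)).ennreal_toReal).const_mul _
  have hD : ∀ k ω, countingMeasure X ω A ≠ ∞ →
      D k ω = ∫ x in A, (⌊k * h x⌋₊ / k : ℝ) ∂(countingMeasure X ω) := by
    intro k ω hω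
    rw [setIntegral_comp_floor hA hhm hh1 hω (fun l => (l / k : ℝ)) k]
    simp [D, mul_comm]
  have hcD : ∀ k, charFun (P.map (D k)) t
      = Complex.exp (∫ x in A, (Complex.exp (t * (⌊k * h x⌋₊ / k : ℝ) * Complex.I) - 1) ∂Λ) := by
    intro k
    have hind : iIndepFun (fun (l : Fin (k + 1)) ω =>
        ((l : ℕ) / k : ℝ) * (countingMeasure X ω (levelCell A h k l)).toReal) P :=
      (hX.indep (k + 1) (fun l => levelCell A h k l) (fun l => measurableSet_levelCell hA hhm k l)
        (fun l l' hl => disjoint_levelCell A h k (fun h' => hl (Fin.ext h')))).comp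
        (fun l x => ((l : ℕ) / k : ℝ) * x.toReal)
        (fun l => ENNReal.measurable_toReal.const_mul _)
    rw [hind.charFun_map_fun_sum_eq_prod (fun l : Fin (k + 1) => (((measurable_countingMeasure hX.measurable
      (measurableSet_levelCell hA hhm k l)).ennreal_toReal).const_mul _).aemeasurable),
      Finset.prod_apply]
    rw [setIntegral_comp_floor hA hhm hh1 hΛ
      (fun l => Complex.exp (t * (l / k : ℝ) * Complex.I) - 1) k, Complex.exp_sum]
    refine Finset.prod_congr rfl fun l _ => ?_
    rw [hX.charFun_mul_count (measurableSet_levelCell hA hhm k l)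
      (measure_ne_top_of_subset Set.inter_subset_left hΛ), Complex.real_smul]
  -- The limit `k → ∞` is taken in two ways: through the random variables here, and through the
  -- explicit formula in `hlim2`.
  have hlim1 : Tendsto (fun k => charFun (P.map (D k)) t) atTop
      (𝓝 (charFun (P.map fun ω => (uStat X (fun x : Unit → E => H (x ())) ω).toReal) t)) := by
    simp only [charFun_apply_real]
    rw [integral_map hLm.ennreal_toReal.aemeasurable (by fun_prop)]
    simp_rw [fun k => integral_map (μ := P) (φ := D k) (hDm k).aemeasurable
      (f := fun x : ℝ => Complex.exp (t * x * Complex.I)) (by fun_prop)]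
    refine tendsto_integral_of_dominated_convergence (fun _ => 1) (fun k => ?_)
      (integrable_const _) (fun k => ?_) ?_
    · have := hDm k
      fun_prop
    · refine Eventually.of_forall fun ω => ?_
      rw [← Complex.ofReal_mul, Complex.norm_exp_ofReal_mul_I]
    · filter_upwards [hNfin] with ω hω
      have : Tendsto (fun k => D k ω) atTop
          (𝓝 (uStat X (fun x : Unit → E => H (x ())) ω).toReal) := by
        rw [hLint ω hω]
        simp_rw [fun k => hD k ω hω]
        have : IsFiniteMeasure ((countingMeasure X ω).restrict A) := ⟨by simpa using hω.lt_top⟩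
        refine tendsto_integral_of_dominated_convergence (fun _ => 1) (fun k => ?_)
          (integrable_const _) (fun k => ?_) ?_
        · exact ((measurable_from_nat (f := fun l : ℕ => (l / k : ℝ))).comp
            (measurable_floor_mul hhm k)).aestronglyMeasurable
        · refine Eventually.of_forall fun x => ?_
          rw [Real.norm_of_nonneg (by positivity)]
          exact floor_mul_div_le_one (hh1 x) k
        · exact Eventually.of_forall fun x => tendsto_floor_mul_div (hh0 x)
      have hcont : Continuous fun x : ℝ => Complex.exp (t * x * Complex.I) := by fun_prop
      exact (hcont.tendsto _).comp this
  have hlim2 : Tendsto (fun k => charFun (P.map (D k)) t) atTop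
      (𝓝 (Complex.exp (∫ x in A, (Complex.exp (t * h x * Complex.I) - 1) ∂Λ))) := by
    simp_rw [hcD]
    refine (Complex.continuous_exp.tendsto _).comp ?_
    have : IsFiniteMeasure (Λ.restrict A) := ⟨by simpa using hΛ.lt_top⟩
    refine tendsto_integral_of_dominated_convergence (fun _ => 2) (fun k => ?_)
      (integrable_const _) (fun k => ?_) ?_
    · exact ((measurable_from_nat (f := fun l : ℕ =>
        Complex.exp (t * (l / k : ℝ) * Complex.I) - 1)).comp
            (measurable_floor_mul hhm k)).aestronglyMeasurable
    · refine Eventually.of_forall fun x => ?_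
      refine (norm_sub_le _ _).trans ?_
      rw [← Complex.ofReal_mul, Complex.norm_exp_ofReal_mul_I]
      norm_num
    · refine Eventually.of_forall fun x => ?_
      have hcont : Continuous fun x : ℝ => Complex.exp (t * x * Complex.I) - 1 := by fun_prop
      exact (hcont.tendsto _).comp (tendsto_floor_mul_div (hh0 x))
  exact tendsto_nhds_unique hlim1 hlim2

end CharFun

/-! ### The central limit theorem for the linear part -/

lemma norm_exp_mul_I_sub_taylor_le {x : ℝ} (hx : |x| ≤ 1) :
    ‖Complex.exp (x * Complex.I) - 1 - x * Complex.I + x ^ 2 / 2‖ ≤ |x| ^ 3 := by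
  have hn : ‖(x * Complex.I : ℂ)‖ = |x| := by simp
  have h := Complex.exp_bound (x := x * Complex.I) (hn.trans_le hx) (n := 3) (by norm_num)
  rw [hn] at h
  have h2 : Complex.exp (x * Complex.I) - ∑ k ∈ Finset.range 3, (x * Complex.I) ^ k / k.factorial
      = Complex.exp (x * Complex.I) - 1 - x * Complex.I + x ^ 2 / 2 := by
    simp [Finset.sum_range_succ, mul_pow]
    ring
  rw [h2] at h
  refine h.trans (mul_le_of_le_one_right (by positivity) ?_)
  norm_num [Nat.factorial]

section CLT

variable {Ω S : Type*} [MeasurableSpace Ω] [MeasurableSpace S] {X : ℕ → Ω → ℝ × S} {lam : ℝ}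
  {Θ : Measure S} [IsProbabilityMeasure Θ] {P : Measure Ω} [IsProbabilityMeasure P]

/-- The characteristic function of a normalized Poisson integral is asymptotically Gaussian. -/
lemma exists_charFun_linear_eq (hlam : 0 < lam)
    (hX : IsPoissonProcess X (ENNReal.ofReal lam • (volume : Measure ℝ).prod Θ) P)
    {r : ℝ} (hr : 0 < r) {H : ℝ × S → ℝ≥0∞} (hH : Measurable H) (hH1 : ∀ x, H x ≤ 1)
    (hHA : ∀ x, x ∉ (Set.Icc (-r) r ×ˢ Set.univ : Set (ℝ × S)) → H x = 0) {t θ v : ℝ}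
    (hθ : ∫ x, (H x).toReal
      ∂((ProbabilityTheory.cond (volume : Measure ℝ) (Set.Icc (-r) r)).prod Θ) = θ)
    (hv : ∫ x, (H x).toReal ^ 2
      ∂((ProbabilityTheory.cond (volume : Measure ℝ) (Set.Icc (-r) r)).prod Θ) = v)
    (ht : |t| ≤ √(2 * lam * r)) :
    ∃ z : ℂ, ‖z‖ ≤ |t| ^ 3 * (√(2 * lam * r))⁻¹ ∧
      charFun (P.map fun ω => (√(2 * lam * r))⁻¹ *
        ((uStat X (fun x : Unit → ℝ × S => H (x ())) ω).toReal - 2 * lam * r * θ)) t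
        = Complex.exp (-(v * t ^ 2 / 2) + z) := by
  have := isProbabilityMeasure_cond_Icc hr
  set μ := (ProbabilityTheory.cond (volume : Measure ℝ) (Set.Icc (-r) r)).prod Θ with hμ
  set A : Set (ℝ × S) := Set.Icc (-r) r ×ˢ Set.univ with hA
  set m := 2 * lam * r with hm
  have hm0 : 0 < m := by positivity
  have hsq : √m ^ 2 = m := Real.sq_sqrt hm0.le
  have hsq0 : 0 < √m := Real.sqrt_pos.2 hm0
  -- The frequency at which the statistic before normalization is evaluated; it satisfies `m * s ^ 2
  -- = t ^ 2`.
  set s := t * (√m)⁻¹ with hs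
  have hs1 : |s| ≤ 1 := by
    rw [hs, abs_mul, abs_inv, abs_of_pos hsq0]
    exact mul_inv_le_one_of_le₀ ht hsq0.le
  have hms : m * s ^ 2 = t ^ 2 := by
    rw [hs]; rw [mul_pow, inv_pow, hsq]; field_simp
  set h : ℝ × S → ℝ := fun x => (H x).toReal with hh
  have hhm : Measurable h := hH.ennreal_toReal
  have hh0 : ∀ x, 0 ≤ h x := fun x => ENNReal.toReal_nonneg
  have hh1 : ∀ x, h x ≤ 1 := fun x =>
    ENNReal.toReal_le_of_le_ofReal zero_le_one (by simpa using hH1 x)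
  have hbd : ∀ {F : Type} [NormedAddCommGroup F] (f : ℝ × S → F) (C : ℝ),
      AEStronglyMeasurable f μ → (∀ x, ‖f x‖ ≤ C) → Integrable f μ := fun f C hf hC =>
    Integrable.of_bound hf C (Eventually.of_forall hC)
  have hL := hX.charFun_linear (measurableSet_Icc.prod MeasurableSet.univ : MeasurableSet A)
    (by rw [intensity_strip, volume_Icc_neg_self]
        exact ENNReal.mul_ne_top ENNReal.ofReal_ne_top ENNReal.ofReal_ne_top) hH hH1 hHA s
  rw [restrict_strip Θ hlam hr, integral_smul_measure, ENNReal.toReal_ofReal hm0.le] at hL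
  have hLm : Measurable fun ω => (uStat X (fun x : Unit → ℝ × S => H (x ())) ω).toReal :=
    (measurable_uStat hX.measurable (hH.comp (measurable_pi_apply ()))).ennreal_toReal
  have hcf : charFun (P.map fun ω => (√m)⁻¹ *
        ((uStat X (fun x : Unit → ℝ × S => H (x ())) ω).toReal - m * θ)) t
      = charFun (P.map fun ω => (uStat X (fun x : Unit → ℝ × S => H (x ())) ω).toReal) s
        * Complex.exp (-(s * m * θ) * Complex.I) := by
    simp only [charFun_apply_real]
    rw [integral_map ((hLm.sub_const _).const_mul _).aemeasurable (by fun_prop),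
      integral_map hLm.aemeasurable (by fun_prop),
      ← integral_mul_const]
    refine integral_congr_ae (Eventually.of_forall fun ω => ?_)
    simp only
    rw [← Complex.exp_add]
    congr 1
    rw [hs]; push_cast; ring
  -- The error `z` is `m` times the integrated Taylor remainder, of size at most `m * |s| ^ 3 = |t|
  -- ^ 3 / √m`. The linear Taylor term cancels the centering and the quadratic one gives the
  -- variance.
  refine ⟨m * ∫ x, (Complex.exp ((s * h x : ℝ) * Complex.I) - 1 - (s * h x : ℝ) * Complex.I
    + ((s * h x : ℝ) : ℂ) ^ 2 / 2) ∂μ, ?_, ?_⟩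
  · rw [norm_mul, Complex.norm_real, Real.norm_of_nonneg hm0.le]
    have hb : ‖∫ x, (Complex.exp ((s * h x : ℝ) * Complex.I) - 1 - (s * h x : ℝ) * Complex.I
        + ((s * h x : ℝ) : ℂ) ^ 2 / 2) ∂μ‖ ≤ |s| ^ 3 := by
      refine (norm_integral_le_of_norm_le_const (C := |s| ^ 3)
        (Eventually.of_forall fun x => ?_)).trans (by simp)
      have hsx : |s * h x| ≤ |s| := by
        rw [abs_mul, abs_of_nonneg (hh0 x)]
        exact mul_le_of_le_one_right (abs_nonneg s) (hh1 x)
      refine (norm_exp_mul_I_sub_taylor_le (hsx.trans hs1)).trans ?_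
      gcongr
    refine (mul_le_mul_of_nonneg_left hb hm0.le).trans (le_of_eq ?_)
    rw [hs, abs_mul, abs_inv, abs_of_pos hsq0, mul_pow]
    nth_rewrite 1 [← hsq]
    field_simp
  · rw [hcf, hL, ← Complex.exp_add]
    congr 1
    have hc : ∀ (f : ℝ → ℂ), Continuous f → AEStronglyMeasurable (fun x => f (h x)) μ :=
      fun f hf => (hf.measurable.comp hhm).aestronglyMeasurable
    have i1 : Integrable (fun x => Complex.exp ((s * h x : ℝ) * Complex.I) - 1) μ := by
      refine hbd _ 2 (hc (fun y => Complex.exp ((s * y : ℝ) * Complex.I) - 1) (by fun_prop))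
        fun x => ?_
      refine (norm_sub_le _ _).trans ?_
      rw [Complex.norm_exp_ofReal_mul_I]; norm_num
    have i0 : Integrable h μ := hbd _ 1 hhm.aestronglyMeasurable fun x => by
      rw [Real.norm_of_nonneg (hh0 x)]; exact hh1 x
    have i02 : Integrable (fun x => h x ^ 2) μ := hbd _ 1 (hhm.pow_const 2).aestronglyMeasurable
      fun x => by
        rw [Real.norm_of_nonneg (sq_nonneg _)]
        exact pow_le_one₀ (hh0 x) (hh1 x)
    have e2 : (fun x => ((s * h x : ℝ) : ℂ) * Complex.I)
        = fun x => (s * Complex.I) * ((h x : ℝ) : ℂ) := by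
      funext x; push_cast; ring
    have e3 : (fun x => ((s * h x : ℝ) : ℂ) ^ 2 / 2)
        = fun x => (s ^ 2 / 2 : ℂ) * ((h x ^ 2 : ℝ) : ℂ) := by
      funext x; push_cast; ring
    have i2 : Integrable (fun x => ((s * h x : ℝ) : ℂ) * Complex.I) μ := by
      rw [e2]; exact i0.ofReal.const_mul _
    have i3 : Integrable (fun x => ((s * h x : ℝ) : ℂ) ^ 2 / 2) μ := by
      rw [e3]; exact i02.ofReal.const_mul _
    have i12 : Integrable (fun x => Complex.exp ((s * h x : ℝ) * Complex.I) - 1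
        - ((s * h x : ℝ) : ℂ) * Complex.I) μ := i1.sub i2
    rw [integral_add i12 i3, integral_sub i1 i2, e2, e3, integral_const_mul, integral_const_mul,
      integral_complex_ofReal, integral_complex_ofReal, hθ, hv, Complex.real_smul]
    have hms' : (m : ℂ) * (s : ℂ) ^ 2 = (t : ℂ) ^ 2 := by exact_mod_cast hms
    push_cast
    linear_combination (-v / 2 : ℂ) * hms'

/-- The central limit theorem for Poisson integrals over growing strips. -/
lemma tendstoInDistribution_linear (hlam : 0 < lam)
    (hX : IsPoissonProcess X (ENNReal.ofReal lam • (volume : Measure ℝ).prod Θ) P)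
    {H : ℝ → ℝ × S → ℝ≥0∞} (hH : ∀ r, Measurable (H r)) (hH1 : ∀ r x, H r x ≤ 1)
    (hHA : ∀ r x, x ∉ (Set.Icc (-r) r ×ˢ Set.univ : Set (ℝ × S)) → H r x = 0) {θ v : ℝ}
    (hv0 : 0 ≤ v)
    (hθ : ∀ r, 0 < r → ∫ x, (H r x).toReal
      ∂((ProbabilityTheory.cond (volume : Measure ℝ) (Set.Icc (-r) r)).prod Θ) = θ)
    (hv : ∀ r, 0 < r → ∫ x, (H r x).toReal ^ 2
      ∂((ProbabilityTheory.cond (volume : Measure ℝ) (Set.Icc (-r) r)).prod Θ) = v) :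
    TendstoInDistribution (fun (r : ℝ) ω => (√(2 * lam * r))⁻¹ *
        ((uStat X (fun x : Unit → ℝ × S => H r (x ())) ω).toReal - 2 * lam * r * θ))
      atTop (id : ℝ → ℝ) (fun _ => P) (gaussianReal 0 v.toNNReal) := by
  have hLm : ∀ r, Measurable fun ω => (uStat X (fun x : Unit → ℝ × S => H r (x ())) ω).toReal :=
    fun r => (measurable_uStat hX.measurable
      ((hH r).comp (measurable_pi_apply ()))).ennreal_toReal
  refine ⟨fun r => (((hLm r).sub_const _).const_mul _).aemeasurable, by fun_prop, ?_⟩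
  -- Passing to sequences `u → ∞` allows the use of Lévy's continuity theorem.
  refine tendsto_of_seq_tendsto fun u hu => ?_
  refine ProbabilityMeasure.tendsto_iff_tendsto_charFun.2 fun t => ?_
  simp only [ProbabilityMeasure.coe_mk, Measure.map_id]
  rw [charFun_gaussianReal]
  have hsq : Tendsto (fun k => √(2 * lam * u k)) atTop atTop :=
    Real.tendsto_sqrt_atTop.comp (hu.const_mul_atTop (by positivity))
  have hev : ∀ᶠ k in atTop, 0 < u k ∧ |t| ≤ √(2 * lam * u k) :=
    (hu.eventually_gt_atTop 0).and (hsq.eventually_ge_atTop _)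
  choose! z hz1 hz2 using fun r (h : 0 < r ∧ |t| ≤ √(2 * lam * r)) =>
    exists_charFun_linear_eq hlam hX h.1 (hH r) (hH1 r) (hHA r) (hθ r h.1) (hv r h.1) h.2
  have hz0 : Tendsto (fun k => z (u k)) atTop (𝓝 0) := by
    refine squeeze_zero_norm' (a := fun k => |t| ^ 3 * (√(2 * lam * u k))⁻¹) ?_ ?_
    · filter_upwards [hev] with k hk using hz1 _ hk
    · simpa using (tendsto_inv_atTop_zero.comp hsq).const_mul (|t| ^ 3)
  have hexp : Tendsto (fun k => Complex.exp (-(v * t ^ 2 / 2) + z (u k))) atTop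
      (𝓝 (Complex.exp (-(v * t ^ 2 / 2) + 0))) :=
    (Complex.continuous_exp.tendsto _).comp (hz0.const_add _)
  refine Tendsto.congr' ?_ (hexp.trans (le_of_eq ?_))
  · filter_upwards [hev] with k hk using (hz2 _ hk).symm
  · congr 2
    simp [Real.coe_toNNReal v hv0]

end CLT

/-! ### The central limit theorem for U-statistics -/

section UStatCLT

variable {Ω S : Type*} [MeasurableSpace Ω] [MeasurableSpace S] {X : ℕ → Ω → ℝ × S} {lam : ℝ}
  {Θ : Measure S} [IsProbabilityMeasure Θ] {P : Measure Ω} [IsProbabilityMeasure P]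

/-- The central limit theorem for U-statistics of a Poisson process over growing strips whose
mean and first marginal variance do not depend on the strip. -/
theorem tendstoInDistribution_uStat (hlam : 0 < lam)
    (hX : IsPoissonProcess X (ENNReal.ofReal lam • (volume : Measure ℝ).prod Θ) P) {n : ℕ}
    {g : ℝ → (Fin (n + 1) → ℝ × S) → ℝ≥0∞} (hg : ∀ r, Measurable (g r)) (h1 : ∀ r x, g r x ≤ 1)
    (hgA : ∀ r x, (∃ j, x j ∉ (Set.Icc (-r) r ×ˢ Set.univ : Set (ℝ × S))) → g r x = 0)
    (hsymm : ∀ r (σ : Equiv.Perm (Fin (n + 1))) x, g r (x ∘ σ) = g r x) {θ v : ℝ}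
    (hθ0 : 0 ≤ θ) (hv0 : 0 ≤ v)
    (hθ : ∀ r, 0 < r → ∫⁻ x, g r x ∂(Measure.pi fun _ =>
      (ProbabilityTheory.cond (volume : Measure ℝ) (Set.Icc (-r) r)).prod Θ) = ENNReal.ofReal θ)
    (hv : ∀ r, 0 < r → ∫⁻ x, firstMarginal
        ((ProbabilityTheory.cond (volume : Measure ℝ) (Set.Icc (-r) r)).prod Θ) (g r) x ^ 2
      ∂((ProbabilityTheory.cond (volume : Measure ℝ) (Set.Icc (-r) r)).prod Θ)
        = ENNReal.ofReal v) :
    TendstoInDistribution (fun (r : ℝ) ω =>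
        (n.factorial : ℝ) / (2 * lam * r) ^ (((n + 1 : ℕ) : ℝ) - 1 / 2) *
          ((uStat X (g r) ω).toReal / (n + 1).factorial
            - (2 * lam * r) ^ (n + 1) / ((n + 1).factorial : ℝ) * θ))
      atTop (id : ℝ → ℝ) (fun _ => P) (gaussianReal 0 v.toNNReal) := by
  let μ : ℝ → Measure (ℝ × S) := fun r =>
    (ProbabilityTheory.cond (volume : Measure ℝ) (Set.Icc (-r) r)).prod Θ
  have hμ : ∀ r, 0 < r → IsProbabilityMeasure (μ r) := fun r hr => by
    have := isProbabilityMeasure_cond_Icc hr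
    infer_instance
  -- For `r ≤ 0` the strip carries no probability law; the default `0` keeps the bounds valid for
  -- all `r` and does not affect the limit.
  let H : ℝ → ℝ × S → ℝ≥0∞ := fun r => if 0 < r then firstMarginal (μ r) (g r) else 0
  have hHpos : ∀ r, 0 < r → H r = firstMarginal (μ r) (g r) := fun r hr => if_pos hr
  have hHm : ∀ r, Measurable (H r) := by
    intro r
    by_cases hr : 0 < r
    · have := hμ r hr
      rw [hHpos r hr]; exact measurable_firstMarginal _ (hg r)
    · simp only [H, if_neg hr]; exact measurable_zero
  have hH1 : ∀ r x, H r x ≤ 1 := by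
    intro r x
    by_cases hr : 0 < r
    · have := hμ r hr
      rw [hHpos r hr]; exact firstMarginal_le_one _ (h1 r) x
    · simp [H, if_neg hr]
  have hHA : ∀ r x, x ∉ (Set.Icc (-r) r ×ˢ Set.univ : Set (ℝ × S)) → H r x = 0 := by
    intro r x hx
    by_cases hr : 0 < r
    · have := hμ r hr
      rw [hHpos r hr]; exact firstMarginal_eq_zero (hgA r) hx
    · simp [H, if_neg hr]
  have hHfin : ∀ r x, H r x < ∞ := fun r x => (hH1 r x).trans_lt ENNReal.one_lt_top
  have hHθ : ∀ r, 0 < r → ∫ x, (H r x).toReal ∂(μ r) = θ := by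
    intro r hr
    have := hμ r hr
    rw [integral_toReal (hHm r).aemeasurable (Eventually.of_forall (hHfin r)), hHpos r hr,
      lintegral_firstMarginal _ (hg r), hθ r hr, ENNReal.toReal_ofReal hθ0]
  have hHv : ∀ r, 0 < r → ∫ x, (H r x).toReal ^ 2 ∂(μ r) = v := by
    intro r hr
    simp_rw [← ENNReal.toReal_pow]
    rw [integral_toReal ((hHm r).pow_const 2).aemeasurable
      (Eventually.of_forall fun x => ENNReal.pow_lt_top (hHfin r x)), hHpos r hr, hv r hr,
      ENNReal.toReal_ofReal hv0]
  have hlin := tendstoInDistribution_linear hlam hX hHm hH1 hHA hv0 hHθ hHv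
  have hWm : ∀ r, Measurable fun ω => (uStat X (g r) ω).toReal := fun r =>
    (measurable_uStat hX.measurable (hg r)).ennreal_toReal
  -- Slutsky: it suffices that the normalized U-statistic minus the normalized linear part tends to
  -- `0` in probability.
  refine tendstoInDistribution_of_tendstoInMeasure_sub _ _ hlin ?_
    fun r => (((hWm r).div_const _).sub_const _ |>.const_mul _).aemeasurable
  rw [tendstoInMeasure_iff_measureReal_norm]
  intro ε hε
  have hbound : Tendsto (fun r : ℝ => overlapConst n / ε ^ 2 * (2 * lam * r)⁻¹) atTop (𝓝 0) := by
    have h : Tendsto (fun r : ℝ => 2 * lam * r) atTop atTop :=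
      tendsto_id.const_mul_atTop (by positivity)
    simpa using (tendsto_inv_atTop_zero.comp h).const_mul (overlapConst n / ε ^ 2)
  refine squeeze_zero' (Eventually.of_forall fun r => measureReal_nonneg) ?_ hbound
  have hev : ∀ᶠ r : ℝ in atTop, 0 < r ∧ 1 ≤ 2 * lam * r :=
    (eventually_gt_atTop 0).and
      ((tendsto_id.const_mul_atTop (by positivity : 0 < 2 * lam)).eventually_ge_atTop 1)
  filter_upwards [hev] with r ⟨hr, hm1⟩
  have hprob := hμ r hr
  have hm0 : 0 < 2 * lam * r := by positivity
  have hθ' : (∫⁻ x, g r x ∂(Measure.pi fun _ => μ r)).toReal = θ := by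
    rw [hθ r hr, ENNReal.toReal_ofReal hθ0]
  obtain ⟨-, hWLp, hLLp, hD⟩ := integral_linearization_sq_le (m := 2 * lam * r) hX.measurable
    (campbellOn_strip hlam hX hr) (measurableSet_Icc.prod MeasurableSet.univ) hm1 (hg r) (h1 r)
    (hgA r) (hsymm r)
  rw [hθ', ← hHpos r hr] at hD
  rw [← hHpos r hr] at hLLp
  set m := 2 * lam * r with hm
  set W : Ω → ℝ := fun ω => (uStat X (g r) ω).toReal with hW
  set L : Ω → ℝ := fun ω => (uStat X (fun x : Unit → ℝ × S => H r (x ())) ω).toReal with hL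
  set D : Ω → ℝ := fun ω => W ω - m ^ (n + 1) * θ - (n + 1) * m ^ n * (L ω - m * θ) with hDdef
  have hDint : Integrable (fun ω => D ω ^ 2) P := by
    have : MemLp D 2 P := (hWLp.sub (memLp_const _)).sub
      ((hLLp.sub (memLp_const _)).const_mul _)
    exact this.integrable_sq
  have hsq : √m ^ 2 = m := Real.sq_sqrt hm0.le
  have hsq0 : 0 < √m := Real.sqrt_pos.2 hm0
  have hpow : m ^ (((n + 1 : ℕ) : ℝ) - 1 / 2) = m ^ n * √m := by
    rw [show ((n + 1 : ℕ) : ℝ) - 1 / 2 = (n : ℝ) + 1 / 2 by push_cast; ring,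
      Real.rpow_add hm0, Real.rpow_natCast, Real.sqrt_eq_rpow]
  have hdiff : ∀ ω, (n.factorial : ℝ) / m ^ (((n + 1 : ℕ) : ℝ) - 1 / 2) *
      (W ω / (n + 1).factorial - m ^ (n + 1) / ((n + 1).factorial : ℝ) * θ)
        - (√m)⁻¹ * (L ω - m * θ) = ((n + 1) * m ^ n * √m)⁻¹ * D ω := by
    intro ω
    rw [hpow, Nat.factorial_succ, hDdef]
    have : (n.factorial : ℝ) ≠ 0 := by positivity
    push_cast
    field_simp
  have hset : {ω | ε ≤ ‖((fun (r : ℝ) ω => (n.factorial : ℝ) /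
        (2 * lam * r) ^ (((n + 1 : ℕ) : ℝ) - 1 / 2) * ((uStat X (g r) ω).toReal / (n + 1).factorial
            - (2 * lam * r) ^ (n + 1) / ((n + 1).factorial : ℝ) * θ))
        - fun (r : ℝ) ω => (√(2 * lam * r))⁻¹ *
        ((uStat X (fun x : Unit → ℝ × S => H r (x ())) ω).toReal - 2 * lam * r * θ)) r ω
          - (0 : ℝ → Ω → ℝ) r ω‖}
      ⊆ {ω | ε ^ 2 * ((n + 1) * m ^ n * √m) ^ 2 ≤ D ω ^ 2} := by
    intro ω hω
    simp only [Set.mem_ofPred_eq, Pi.sub_apply, Pi.zero_apply, sub_zero] at hω ⊢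
    rw [hdiff ω, norm_mul, norm_inv, Real.norm_of_nonneg (by positivity : 0 ≤ (n + 1) * m ^ n * √m),
      ← div_eq_inv_mul, le_div_iff₀ (by positivity)] at hω
    rw [← mul_pow, ← sq_abs (D ω)]
    exact pow_le_pow_left₀ (by positivity) hω 2
  refine (measureReal_mono hset).trans ?_
  -- Chebyshev's inequality: the mean square of `D` is at most a constant times `m ^ (2 * n)`, while
  -- the squared threshold grows like `m ^ (2 * n + 1)`, which leaves a bound of order `m⁻¹`.
  have hmark := mul_meas_ge_le_integral_of_nonneg (μ := P) (f := fun ω => D ω ^ 2)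
    (Eventually.of_forall fun ω => sq_nonneg _) hDint (ε ^ 2 * ((n + 1) * m ^ n * √m) ^ 2)
  have hc : 0 < ε ^ 2 * ((n + 1) * m ^ n * √m) ^ 2 := by positivity
  rw [mul_comm, ← le_div_iff₀ hc] at hmark
  refine hmark.trans ?_
  rw [div_le_iff₀ hc]
  refine hD.trans ?_
  have : (overlapConst n : ℝ) / ε ^ 2 * m⁻¹ * (ε ^ 2 * ((n + 1) * m ^ n * √m) ^ 2)
      = overlapConst n * m ^ (2 * n) * (n + 1) ^ 2 := by
    rw [mul_pow _ (√m), hsq]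
    field_simp
    ring
  rw [this]
  refine le_mul_of_one_le_right (by positivity) ?_
  have : (0 : ℝ) ≤ n := Nat.cast_nonneg n
  nlinarith

end UStatCLT

/-! ### Intersections of `d` hyperplanes -/

section Geometry

variable {d : ℕ}

/-- The matrix whose rows are the orientation vectors. -/
def normalMatrix (V : Fin d → UpperHemisphere d) : Matrix (Fin d) (Fin d) ℝ :=
  Matrix.of fun j k => (V j : EuclideanSpace ℝ (Fin d)) k

lemma mem_flatInter_iff {q : Fin d → ℝ × UpperHemisphere d} {x : EuclideanSpace ℝ (Fin d)} :
    x ∈ flatInter q ↔ (normalMatrix fun j => (q j).2).mulVec x.ofLp = fun j => (q j).1 := by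
  simp only [flatInter, hyperplane, Set.mem_iInter, Set.mem_ofPred_eq, funext_iff]
  refine forall_congr' fun j => ?_
  simp [PiLp.inner_apply, Matrix.mulVec, dotProduct, normalMatrix]

/-- A nonempty intersection is a translate of the kernel of the matrix of normals. The right-hand
side splits the condition into a closed one and a polynomial one, which gives measurability. -/
lemma exists_flatInter_eq_singleton_iff (q : Fin d → ℝ × UpperHemisphere d)
    (A : Set (EuclideanSpace ℝ (Fin d))) :
    (∃ x ∈ A, flatInter q = {x}) ↔
      (flatInter q ∩ A).Nonempty ∧ (normalMatrix fun j => (q j).2).det ≠ 0 := by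
  constructor
  · rintro ⟨x, hx, h⟩
    have hxq : x ∈ flatInter q := h ▸ rfl
    refine ⟨⟨x, hxq, hx⟩, fun hdet => ?_⟩
    obtain ⟨w, hw, hw0⟩ := Matrix.exists_mulVec_eq_zero_iff.2 hdet
    have hmem : x + WithLp.toLp 2 w ∈ flatInter q := by
      rw [mem_flatInter_iff] at hxq ⊢
      rw [WithLp.ofLp_add, Matrix.mulVec_add, hxq, hw0, add_zero]
    rw [h, Set.mem_singleton_iff, add_eq_left] at hmem
    exact hw (by simpa using hmem)
  · rintro ⟨⟨x, hxq, hx⟩, hdet⟩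
    refine ⟨x, hx, Set.eq_singleton_iff_unique_mem.2 ⟨hxq, fun y hy => ?_⟩⟩
    rw [mem_flatInter_iff] at hxq hy
    have h0 : (normalMatrix fun j => (q j).2).mulVec (y.ofLp - x.ofLp) = 0 := by
      rw [Matrix.mulVec_sub, hy, hxq, sub_self]
    by_contra hne
    refine hdet (Matrix.exists_mulVec_eq_zero_iff.1 ⟨_, fun h => hne ?_, h0⟩)
    exact WithLp.ofLp_injective 2 (sub_eq_zero.1 h)

/-- The set is the projection, along the compact ball, of the closed incidence relation between
points and tuples of hyperplanes. -/
lemma isClosed_flatInter_inter_closedBall (r : ℝ) :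
    IsClosed {q : Fin d → ℝ × UpperHemisphere d |
      (flatInter q ∩ Metric.closedBall 0 r).Nonempty} := by
  let K : Set (EuclideanSpace ℝ (Fin d)) := Metric.closedBall 0 r
  have : CompactSpace K := isCompact_iff_compactSpace.1 (isCompact_closedBall 0 r)
  let Z : Set (K × (Fin d → ℝ × UpperHemisphere d)) :=
    {p | ∀ j, inner ℝ (p.1 : EuclideanSpace ℝ (Fin d)) ((p.2 j).2 : EuclideanSpace ℝ (Fin d))
      = (p.2 j).1}
  have hZ : IsClosed Z := by
    simp only [Z, Set.ofPred_forall]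
    refine isClosed_iInter fun j => isClosed_eq ?_ ?_ <;> fun_prop
  have := isClosedMap_snd_of_compactSpace Z hZ
  convert this using 1
  ext q
  constructor
  · rintro ⟨x, hx, hK⟩
    exact ⟨(⟨x, hK⟩, q), fun j => Set.mem_iInter.1 hx j, rfl⟩
  · rintro ⟨⟨x, q'⟩, hx, rfl⟩
    exact ⟨x, Set.mem_iInter.2 fun j => hx j, x.2⟩

lemma measurable_det_normalMatrix :
    Measurable fun q : Fin d → ℝ × UpperHemisphere d => (normalMatrix fun j => (q j).2).det := by
  refine Continuous.measurable (Continuous.matrix_det ?_)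
  refine continuous_matrix fun j k => ?_
  simp only [normalMatrix, Matrix.of_apply]
  fun_prop

lemma pi_cond_absolutelyContinuous {r : ℝ} (hr : 0 < r) :
    (Measure.pi fun _ : Fin d => ProbabilityTheory.cond (volume : Measure ℝ) (Set.Icc (-r) r))
      ≪ volume := by
  have := isProbabilityMeasure_cond_Icc hr
  have h : (Measure.pi fun _ : Fin d =>
        ProbabilityTheory.cond (volume : Measure ℝ) (Set.Icc (-r) r))
      = (volume (Set.Icc (-r) r))⁻¹ ^ d •
        (volume : Measure (Fin d → ℝ)).restrict (Set.univ.pi fun _ => Set.Icc (-r) r) := by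
    refine Measure.pi_eq fun s hs => ?_
    rw [volume_pi, Measure.restrict_pi_pi, Measure.smul_apply, Measure.pi_pi]
    simp only [ProbabilityTheory.cond, Measure.smul_apply, smul_eq_mul, Finset.prod_mul_distrib,
      Finset.prod_const, Finset.card_univ, Fintype.card_fin]
  rw [h]
  exact (Measure.absolutelyContinuous_of_le Measure.restrict_le_self).smul_left _

/-- Hyperplanes with linearly dependent orientation vectors almost surely have no common point. -/
lemma measure_degenerate_eq_zero (Θ : Measure (UpperHemisphere d)) [IsProbabilityMeasure Θ]
    {r : ℝ} (hr : 0 < r) :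
    (Measure.pi fun _ : Fin d => hittingLaw r Θ) {q | (flatInter q ∩ Metric.closedBall 0 r).Nonempty
      ∧ (normalMatrix fun j => (q j).2).det = 0} = 0 := by
  have := isProbabilityMeasure_cond_Icc hr
  set Z : Set (Fin d → ℝ × UpperHemisphere d) :=
    {q | (flatInter q ∩ Metric.closedBall 0 r).Nonempty
      ∧ (normalMatrix fun j => (q j).2).det = 0} with hZdef
  have hZ : MeasurableSet Z :=
    (isClosed_flatInter_inter_closedBall r).measurableSet.inter
      (measurable_det_normalMatrix (measurableSet_singleton 0))
  have hmp := measurePreserving_arrowProdEquivProdArrow ℝ (UpperHemisphere d) (Fin d)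
    (fun _ => ProbabilityTheory.cond (volume : Measure ℝ) (Set.Icc (-r) r)) (fun _ => Θ)
  have hmp' := hmp.symm
  change (Measure.pi fun _ : Fin d =>
    (ProbabilityTheory.cond (volume : Measure ℝ) (Set.Icc (-r) r)).prod Θ) Z = 0
  -- Signed distances and orientations are separated, so that Fubini reduces the claim to fixed
  -- orientations `V`.
  rw [← hmp'.measure_preimage hZ.nullMeasurableSet,
    Measure.prod_apply_symm (hmp'.measurable hZ)]
  refine (lintegral_congr fun V => ?_).trans lintegral_zero
  by_cases hdet : (normalMatrix V).det = 0
  -- For singular normals a common point exists only if the vector of distances lies in the range of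
  -- the matrix, a proper subspace and hence a Lebesgue null set. For nonsingular normals the
  -- section is empty.
  · refine pi_cond_absolutelyContinuous hr (measure_mono_null (t := LinearMap.range
      (normalMatrix V).mulVecLin) ?_ (Measure.addHaar_submodule volume _ ?_))
    · rintro p ⟨⟨x, hx, -⟩, -⟩
      exact ⟨x.ofLp, mem_flatInter_iff.1 hx⟩
    · intro htop
      obtain ⟨w, hw, hw0⟩ := Matrix.exists_mulVec_eq_zero_iff.2 hdet
      have hinj := LinearMap.injective_iff_surjective.2 (LinearMap.range_eq_top.1 htop)
      exact hw (hinj (by simpa using hw0))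
  · convert measure_empty (μ := Measure.pi fun _ : Fin d =>
      ProbabilityTheory.cond (volume : Measure ℝ) (Set.Icc (-r) r))
    ext p
    simp only [Set.mem_empty_iff_false, iff_false]
    rintro ⟨-, h⟩
    exact hdet h

end Geometry

/-! ### Measurability and symmetry of the sorted marks -/

section Marks

variable {d : ℕ} [LinearOrder (UpperHemisphere d)]

lemma sortedMarks_comp_perm (q : Fin d → ℝ × UpperHemisphere d) (σ : Equiv.Perm (Fin d)) :
    sortedMarks (q ∘ σ) = sortedMarks q :=
  Tuple.comp_perm_comp_sort_eq_comp_sort (f := fun j => (q j).2) (σ := σ)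

/-- The space of tuples splits into finitely many pieces according to the sorting permutation. Each
piece is cut out by order relations and ties between coordinates, and on it sorting is a fixed
permutation of coordinates. -/
lemma measurableSet_sortedMarks_mem
    (hle : MeasurableSet {q : UpperHemisphere d × UpperHemisphere d | q.1 ≤ q.2})
    {B : Set (Fin d → UpperHemisphere d)} (hB : MeasurableSet B) :
    MeasurableSet {q : Fin d → ℝ × UpperHemisphere d | sortedMarks q ∈ B} := by
  have hle' : ∀ a b : Fin d,
      MeasurableSet {q : Fin d → ℝ × UpperHemisphere d | (q a).2 ≤ (q b).2} := fun a b =>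
    (show Measurable fun q : Fin d → ℝ × UpperHemisphere d => ((q a).2, (q b).2) by fun_prop) hle
  have heq' : ∀ a b : Fin d,
      MeasurableSet {q : Fin d → ℝ × UpperHemisphere d | (q a).2 = (q b).2} := fun a b => by
    simp only [le_antisymm_iff]
    exact (hle' a b).inter (hle' b a)
  have hsort : ∀ σ : Equiv.Perm (Fin d), MeasurableSet
      {q : Fin d → ℝ × UpperHemisphere d | σ = Tuple.sort fun j => (q j).2} := by
    intro σ
    simp only [Tuple.eq_sort_iff, Monotone, Function.comp_apply, Set.ofPred_and, Set.ofPred_forall]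
    refine MeasurableSet.inter ?_ ?_
    · exact MeasurableSet.iInter fun a => MeasurableSet.iInter fun b =>
        MeasurableSet.iInter fun _ => hle' _ _
    · refine MeasurableSet.iInter fun a => MeasurableSet.iInter fun b =>
        MeasurableSet.iInter fun _ => ?_
      simp only [imp_iff_not_or, Set.ofPred_or]
      exact (heq' _ _).compl.union (MeasurableSet.const _)
  have hU : {q : Fin d → ℝ × UpperHemisphere d | sortedMarks q ∈ B}
      = ⋃ σ : Equiv.Perm (Fin d), {q | σ = Tuple.sort fun j => (q j).2} ∩
        {q | (fun j => (q (σ j)).2) ∈ B} := by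
    ext q
    simp only [Set.mem_ofPred_eq, Set.mem_iUnion, Set.mem_inter_iff]
    constructor
    · intro h
      exact ⟨_, rfl, h⟩
    · rintro ⟨σ, rfl, h⟩
      exact h
  rw [hU]
  exact MeasurableSet.iUnion fun σ => (hsort σ).inter
    ((show Measurable fun (q : Fin d → ℝ × UpperHemisphere d) j => (q (σ j)).2 by fun_prop) hB)

end Marks

/-! ### The vertex kernel -/

section Kernel

variable {d : ℕ} [LinearOrder (UpperHemisphere d)]

/-- The tuples of hyperplanes that define a vertex in the ball of radius `r` with marks in `B`. -/
def vertexSet (r : ℝ) (B : Set (Fin d → UpperHemisphere d)) :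
    Set (Fin d → ℝ × UpperHemisphere d) :=
  {q | (∃ x ∈ Metric.closedBall 0 r, flatInter q = {x}) ∧ sortedMarks q ∈ B}

/-- The indicator function of `vertexSet`. -/
noncomputable def vertexKernel (r : ℝ) (B : Set (Fin d → UpperHemisphere d))
    (q : Fin d → ℝ × UpperHemisphere d) : ℝ≥0∞ :=
  (vertexSet r B).indicator 1 q

lemma vertexKernel_le_one (r : ℝ) (B : Set (Fin d → UpperHemisphere d))
    (q : Fin d → ℝ × UpperHemisphere d) : vertexKernel r B q ≤ 1 :=
  Set.indicator_le_self' (by simp) _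

lemma measurableSet_flatInter_sortedMarks
    (hle : MeasurableSet {q : UpperHemisphere d × UpperHemisphere d | q.1 ≤ q.2})
    {B : Set (Fin d → UpperHemisphere d)} (hB : MeasurableSet B) (r : ℝ) :
    MeasurableSet {q : Fin d → ℝ × UpperHemisphere d |
      (flatInter q ∩ Metric.closedBall 0 r).Nonempty ∧ sortedMarks q ∈ B} :=
  (isClosed_flatInter_inter_closedBall r).measurableSet.inter (measurableSet_sortedMarks_mem hle hB)

lemma measurable_vertexKernel
    (hle : MeasurableSet {q : UpperHemisphere d × UpperHemisphere d | q.1 ≤ q.2})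
    {B : Set (Fin d → UpperHemisphere d)} (hB : MeasurableSet B) (r : ℝ) :
    Measurable (vertexKernel r B) := by
  refine measurable_one.indicator ?_
  simp only [vertexSet, exists_flatInter_eq_singleton_iff]
  exact ((isClosed_flatInter_inter_closedBall r).measurableSet.inter
    (measurable_det_normalMatrix (measurableSet_singleton 0).compl)).inter
    (measurableSet_sortedMarks_mem hle hB)

lemma measurable_kernelB
    (hle : MeasurableSet {q : UpperHemisphere d × UpperHemisphere d | q.1 ≤ q.2})
    {B : Set (Fin d → UpperHemisphere d)} (hB : MeasurableSet B) (r : ℝ) :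
    Measurable (kernelB r B) :=
  Measurable.ite (measurableSet_flatInter_sortedMarks hle hB r) measurable_const measurable_const

lemma flatInter_comp_perm {d : ℕ} (q : Fin d → ℝ × UpperHemisphere d)
    (σ : Equiv.Perm (Fin d)) : flatInter (q ∘ σ) = flatInter q :=
  σ.surjective.iInter_comp fun j => hyperplane (q j)

lemma vertexKernel_comp_perm (r : ℝ) (B : Set (Fin d → UpperHemisphere d))
    (σ : Equiv.Perm (Fin d)) (q : Fin d → ℝ × UpperHemisphere d) :
    vertexKernel r B (q ∘ σ) = vertexKernel r B q := by
  have h : q ∘ σ ∈ vertexSet r B ↔ q ∈ vertexSet r B := by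
    rw [vertexSet, Set.mem_ofPred_eq, Set.mem_ofPred_eq, flatInter_comp_perm q σ,
      sortedMarks_comp_perm q σ]
  classical
  simp only [vertexKernel, Set.indicator_apply, h, Pi.one_apply]

lemma kernelB_comp_perm (r : ℝ) (B : Set (Fin d → UpperHemisphere d))
    (σ : Equiv.Perm (Fin d)) (q : Fin d → ℝ × UpperHemisphere d) :
    kernelB r B (q ∘ σ) = kernelB r B q := by
  classical
  unfold kernelB
  refine if_congr ?_ rfl rfl
  rw [flatInter_comp_perm q σ, sortedMarks_comp_perm q σ]

lemma kernelB_nonneg (r : ℝ) (B : Set (Fin d → UpperHemisphere d))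
    (q : Fin d → ℝ × UpperHemisphere d) : 0 ≤ kernelB r B q := by
  unfold kernelB; split_ifs <;> simp

lemma kernelB_le_one (r : ℝ) (B : Set (Fin d → UpperHemisphere d))
    (q : Fin d → ℝ × UpperHemisphere d) : kernelB r B q ≤ 1 := by
  unfold kernelB; split_ifs <;> simp

/-- By Cauchy–Schwarz, a hyperplane through a point `x` of the ball has signed distance `|⟨x, v⟩| ≤
‖x‖ ≤ r`. This confines the U-statistic to a strip. -/
lemma vertexKernel_eq_zero (r : ℝ) (B : Set (Fin d → UpperHemisphere d))
    (q : Fin d → ℝ × UpperHemisphere d)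
    (hq : ∃ j, q j ∉ (Set.Icc (-r) r ×ˢ Set.univ : Set (ℝ × UpperHemisphere d))) :
    vertexKernel r B q = 0 := by
  refine Set.indicator_of_notMem ?_ _
  rintro ⟨⟨x, hx, hxq⟩, -⟩
  obtain ⟨j, hj⟩ := hq
  refine hj ⟨?_, trivial⟩
  have hmem : x ∈ flatInter q := hxq ▸ rfl
  have h1 : inner ℝ x ((q j).2 : EuclideanSpace ℝ (Fin d)) = (q j).1 := Set.mem_iInter.1 hmem j
  have h2 := abs_real_inner_le_norm x ((q j).2 : EuclideanSpace ℝ (Fin d))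
  rw [(q j).2.2.1, mul_one, h1] at h2
  rw [mem_closedBall_zero_iff] at hx
  exact abs_le.1 (h2.trans hx)

/-- The kernels can differ only where the hyperplanes meet in the ball with dependent normals, which
is a null set. -/
lemma vertexKernel_ae_eq (Θ : Measure (UpperHemisphere d)) [IsProbabilityMeasure Θ]
    {r : ℝ} (hr : 0 < r) (B : Set (Fin d → UpperHemisphere d)) :
    ∀ᵐ q ∂(Measure.pi fun _ : Fin d => hittingLaw r Θ),
      vertexKernel r B q = ENNReal.ofReal (kernelB r B q) := by
  refine measure_mono_null (fun q hq => ?_) (measure_degenerate_eq_zero Θ hr)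
  by_contra h
  refine hq ?_
  have hiff : q ∈ vertexSet r B ↔
      (flatInter q ∩ Metric.closedBall 0 r).Nonempty ∧ sortedMarks q ∈ B := by
    simp only [vertexSet, Set.mem_ofPred_eq, exists_flatInter_eq_singleton_iff]
    exact ⟨fun h' => ⟨h'.1.1, h'.2⟩, fun h' => ⟨⟨h'.1, fun h0 => h ⟨h'.1, h0⟩⟩, h'.2⟩⟩
  change vertexKernel r B q = ENNReal.ofReal (kernelB r B q)
  by_cases hm : q ∈ vertexSet r B
  · rw [vertexKernel, Set.indicator_of_mem hm, kernelB, if_pos (hiff.1 hm)]; simp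
  · rw [vertexKernel, Set.indicator_of_notMem hm, kernelB, if_neg (fun h' => hm (hiff.2 h'))]; simp

lemma vertexCount_eq_uStat {Ω : Type*} (X : ℕ → Ω → ℝ × UpperHemisphere d) (r : ℝ)
    (B : Set (Fin d → UpperHemisphere d)) (ω : Ω) :
    vertexCount X (Metric.closedBall 0 r) B ω
      = uStat X (vertexKernel r B) ω / (d.factorial : ℝ≥0∞) := by
  classical
  rw [vertexCount, uStat]
  congr 1
  refine tsum_congr fun e => ?_
  simp only [vertexKernel, Set.indicator_apply, vertexSet, Set.mem_ofPred_eq, Pi.one_apply]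

end Kernel

/-! ### Dilations -/

section Scaling

/-- The dilation by `c` of a hyperplane. -/
def dilate {S : Type*} (c : ℝ) (q : ℝ × S) : ℝ × S := (c * q.1, q.2)

lemma measurePreserving_mul_cond {c ρ : ℝ} (hc : 0 < c) (hρ : 0 < ρ) :
    MeasurePreserving (fun x : ℝ => c * x)
      (ProbabilityTheory.cond (volume : Measure ℝ) (Set.Icc (-ρ) ρ))
      (ProbabilityTheory.cond (volume : Measure ℝ) (Set.Icc (-(c * ρ)) (c * ρ))) := by
  refine ⟨by fun_prop, ?_⟩
  ext s hs
  have hpre : (fun x : ℝ => c * x) ⁻¹' (Set.Icc (-(c * ρ)) (c * ρ) ∩ s)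
      = Set.Icc (-ρ) ρ ∩ (fun x : ℝ => c * x) ⁻¹' s := by
    rw [Set.preimage_inter]
    congr 1
    ext x
    simp only [Set.mem_preimage, Set.mem_Icc, ← mul_neg, mul_le_mul_iff_right₀ hc]
  rw [Measure.map_apply (by fun_prop) hs, cond_apply measurableSet_Icc, cond_apply measurableSet_Icc,
    ← hpre, Real.volume_preimage_mul_left hc.ne', ← mul_assoc, volume_Icc_neg_self,
    volume_Icc_neg_self, abs_of_pos (inv_pos.2 hc)]
  congr 1
  rw [← ENNReal.ofReal_inv_of_pos (by positivity), ← ENNReal.ofReal_inv_of_pos (by positivity),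
    ← ENNReal.ofReal_mul (by positivity)]
  congr 1
  field_simp

variable {d : ℕ}

lemma measurePreserving_dilate (Θ : Measure (UpperHemisphere d)) [IsProbabilityMeasure Θ]
    {c ρ : ℝ} (hc : 0 < c) (hρ : 0 < ρ) :
    MeasurePreserving (dilate c) (hittingLaw ρ Θ) (hittingLaw (c * ρ) Θ) := by
  have := isProbabilityMeasure_cond_Icc hρ
  have := isProbabilityMeasure_cond_Icc (mul_pos hc hρ)
  exact (measurePreserving_mul_cond hc hρ).prod (MeasurePreserving.id Θ)

lemma mem_flatInter_dilate {c : ℝ} (hc : 0 < c) {q : Fin d → ℝ × UpperHemisphere d}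
    {x : EuclideanSpace ℝ (Fin d)} :
    c • x ∈ flatInter (fun j => dilate c (q j)) ↔ x ∈ flatInter q := by
  simp only [flatInter, hyperplane, Set.mem_iInter, Set.mem_ofPred_eq, dilate, inner_smul_left]
  refine forall_congr' fun j => ?_
  simp [hc.ne']

/-- Multiplying signed distances by `c` dilates the common points by `c` and leaves the orientations
unchanged. -/
lemma vertexKernel_dilate [LinearOrder (UpperHemisphere d)] {c : ℝ} (hc : 0 < c) (ρ : ℝ)
    (B : Set (Fin d → UpperHemisphere d)) (q : Fin d → ℝ × UpperHemisphere d) :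
    vertexKernel (c * ρ) B (fun j => dilate c (q j)) = vertexKernel ρ B q := by
  have hball : ∀ x : EuclideanSpace ℝ (Fin d),
      c • x ∈ Metric.closedBall (0 : EuclideanSpace ℝ (Fin d)) (c * ρ)
        ↔ x ∈ Metric.closedBall (0 : EuclideanSpace ℝ (Fin d)) ρ := by
    intro x
    rw [mem_closedBall_zero_iff, mem_closedBall_zero_iff, norm_smul, Real.norm_of_nonneg hc.le,
      mul_le_mul_iff_right₀ hc]
  have hmem : (fun j => dilate c (q j)) ∈ vertexSet (c * ρ) B ↔ q ∈ vertexSet ρ B := by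
    simp only [vertexSet, Set.mem_ofPred_eq, exists_flatInter_eq_singleton_iff]
    refine and_congr (and_congr_left' ?_) Iff.rfl
    constructor
    · rintro ⟨y, hy, hyb⟩
      have : y = c • (c⁻¹ • y) := by rw [smul_inv_smul₀ hc.ne']
      rw [this] at hy hyb
      exact ⟨c⁻¹ • y, (mem_flatInter_dilate hc).1 hy, (hball _).1 hyb⟩
    · rintro ⟨y, hy, hyb⟩
      exact ⟨c • y, (mem_flatInter_dilate hc).2 hy, (hball _).2 hyb⟩
  classical
  simp only [vertexKernel, Set.indicator_apply, hmem, Pi.one_apply]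

end Scaling

/-! ### Mean and variance constants, independent of the radius -/

section Moments

variable {n : ℕ} [LinearOrder (UpperHemisphere (n + 1))]

lemma isProbabilityMeasure_hittingLaw {d : ℕ} (Θ : Measure (UpperHemisphere d))
    [IsProbabilityMeasure Θ] {r : ℝ} (hr : 0 < r) : IsProbabilityMeasure (hittingLaw r Θ) := by
  have := isProbabilityMeasure_cond_Icc hr
  unfold hittingLaw
  infer_instance

/-- The mean of the vertex kernel does not depend on the radius. -/
lemma lintegral_vertexKernel
    (hle : MeasurableSet {q : UpperHemisphere (n + 1) × UpperHemisphere (n + 1) | q.1 ≤ q.2})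
    {B : Set (Fin (n + 1) → UpperHemisphere (n + 1))} (hB : MeasurableSet B)
    (Θ : Measure (UpperHemisphere (n + 1))) [IsProbabilityMeasure Θ] {r ρ : ℝ}
    (hr : 0 < r) (hρ : 0 < ρ) :
    ∫⁻ q, vertexKernel r B q ∂(Measure.pi fun _ => hittingLaw r Θ)
      = ENNReal.ofReal (meanB ρ Θ B) := by
  have := isProbabilityMeasure_hittingLaw Θ hr
  have := isProbabilityMeasure_hittingLaw Θ hρ
  have hc : 0 < r / ρ := div_pos hr hρ
  have hrc : r / ρ * ρ = r := div_mul_cancel₀ r hρ.ne'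
  have hmp := measurePreserving_dilate Θ hc hρ
  rw [hrc] at hmp
  have hpi := measurePreserving_pi (fun _ : Fin (n + 1) => hittingLaw ρ Θ)
    (fun _ => hittingLaw r Θ) (fun _ => hmp)
  rw [← hpi.lintegral_comp (measurable_vertexKernel hle hB r)]
  have h1 : ∀ q : Fin (n + 1) → ℝ × UpperHemisphere (n + 1),
      vertexKernel r B (fun j => dilate (r / ρ) (q j)) = vertexKernel ρ B q := fun q => by
    rw [← vertexKernel_dilate hc ρ B q, hrc]
  simp_rw [h1]
  rw [lintegral_congr_ae (vertexKernel_ae_eq Θ hρ B), meanB,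
    ofReal_integral_eq_lintegral_ofReal]
  · refine Integrable.of_bound (measurable_kernelB hle hB ρ).aestronglyMeasurable 1
      (Eventually.of_forall fun q => ?_)
    rw [Real.norm_of_nonneg (kernelB_nonneg ρ B q)]
    exact kernelB_le_one ρ B q
  · exact Eventually.of_forall fun q => kernelB_nonneg ρ B q

end Moments

/-- The arrangement of the `2 n + 1` arguments of two kernels that share the argument `n`. -/
def sharedIndex (n : ℕ) : Unit ⊕ (Fin n ⊕ Fin n) → Fin (2 * (n + 1) - 1)
  | Sum.inl _ => ⟨n, by omega⟩
  | Sum.inr (Sum.inl k) => ⟨(Equiv.swap 0 (Fin.last n) k.succ : Fin (n + 1)), by omega⟩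
  | Sum.inr (Sum.inr k) => ⟨n + (k.succ : Fin (n + 1)), by omega⟩

lemma swap_last_succ_lt {n : ℕ} (k : Fin n) :
    ((Equiv.swap 0 (Fin.last n) k.succ : Fin (n + 1)) : ℕ) < n := by
  have h : Equiv.swap 0 (Fin.last n) k.succ ≠ Fin.last n := fun h => by
    rw [Equiv.swap_apply_eq_iff, Equiv.swap_apply_right] at h
    exact Fin.succ_ne_zero k h
  exact Fin.val_lt_last h

/-- The three blocks land at `n`, below `n` and above `n` respectively, so they cannot collide; the
cardinalities agree. -/
lemma bijective_sharedIndex (n : ℕ) : Function.Bijective (sharedIndex n) := by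
  rw [Fintype.bijective_iff_injective_and_card]
  refine ⟨?_, by simp; omega⟩
  rintro (a | a | a) (b | b | b) h <;> simp only [sharedIndex, Fin.mk.injEq, Fin.val_succ] at h
  · rfl
  · have := swap_last_succ_lt b; omega
  · omega
  · have := swap_last_succ_lt a; omega
  · rw [Fin.val_inj, EmbeddingLike.apply_eq_iff_eq, Fin.succ_inj] at h
    rw [h]
  · have := swap_last_succ_lt a; omega
  · omega
  · have := swap_last_succ_lt b; omega
  · have : a = b := Fin.ext (by omega)
    rw [this]

/-- Connects the limiting variance of the linear part with the form used in `sigmaB`, where the last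
argument of the first kernel is the first argument of the second. -/
lemma lintegral_firstMarginal_sq_eq {E : Type*} [MeasurableSpace E] (μ : Measure E)
    [IsProbabilityMeasure μ] {n : ℕ} {g : (Fin (n + 1) → E) → ℝ≥0∞} (hg : Measurable g)
    (hsymm : ∀ (σ : Equiv.Perm (Fin (n + 1))) x, g (x ∘ σ) = g x) :
    ∫⁻ x, firstMarginal μ g x ^ 2 ∂μ
      = ∫⁻ q : Fin (2 * (n + 1) - 1) → E,
          g (fun j : Fin (n + 1) => q ⟨j, by omega⟩) *
            g (fun j : Fin (n + 1) => q ⟨n + 1 - 1 + j, by omega⟩)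
          ∂(Measure.pi fun _ => μ) := by
  rw [← lintegral_mul_sharing_one μ hg]
  have hc := (measurePreserving_cons μ n).measurable
  have hF : Measurable fun x : Unit ⊕ (Fin n ⊕ Fin n) → E =>
      g (Fin.cons (x (Sum.inl ())) fun k => x (Sum.inr (Sum.inl k))) *
          g (Fin.cons (x (Sum.inl ())) fun k => x (Sum.inr (Sum.inr k))) :=
    ((hg.comp hc).comp (Measurable.prodMk (by fun_prop) (by fun_prop))).mul
      ((hg.comp hc).comp (Measurable.prodMk (by fun_prop) (by fun_prop)))
  rw [← (measurePreserving_comp_equiv μ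
    (Equiv.ofBijective _ (bijective_sharedIndex n))).lintegral_comp hF]
  refine lintegral_congr fun q => ?_
  congr 1
  -- Only the first kernel needs symmetry, to move its shared argument from last to first place; in
  -- the second kernel it already comes first.
  · exact (kernel_eq_cons hsymm (fun j : Fin (n + 1) => q ⟨j, by omega⟩) (Fin.last n)).symm
  · congr 1
    funext j
    refine Fin.cases ?_ (fun k => ?_) j <;> rfl

/-- By Fubini, kernels that agree almost everywhere agree for almost every first argument and almost
all others. -/
lemma lintegral_firstMarginal_sq_congr {E : Type*} [MeasurableSpace E] (μ : Measure E)
    [IsProbabilityMeasure μ] {n : ℕ} {g k : (Fin (n + 1) → E) → ℝ≥0∞}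
    (h : g =ᵐ[Measure.pi fun _ => μ] k) :
    ∫⁻ x, firstMarginal μ g x ^ 2 ∂μ = ∫⁻ x, firstMarginal μ k x ^ 2 ∂μ := by
  refine lintegral_congr_ae ?_
  have h1 := (measurePreserving_cons μ n).quasiMeasurePreserving.ae h
  filter_upwards [Measure.ae_ae_of_ae_prod h1] with x hx
  rw [firstMarginal, firstMarginal, lintegral_congr_ae hx]

lemma lintegral_firstMarginal_sq_comp {E F : Type*} [MeasurableSpace E] [MeasurableSpace F]
    {μ : Measure E} {ν : Measure F} [IsProbabilityMeasure μ] [IsProbabilityMeasure ν]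
    {T : E → F} (hT : MeasurePreserving T μ ν) {n : ℕ} {g : (Fin (n + 1) → F) → ℝ≥0∞}
    (hg : Measurable g) :
    ∫⁻ x, firstMarginal ν g x ^ 2 ∂ν
      = ∫⁻ x, firstMarginal μ (fun q => g fun j => T (q j)) x ^ 2 ∂μ := by
  rw [← hT.lintegral_comp ((measurable_firstMarginal ν hg).pow_const 2)]
  refine lintegral_congr fun x => ?_
  have hpi := measurePreserving_pi (fun _ : Fin n => μ) (fun _ => ν) fun _ => hT
  have hgx : Measurable fun y : Fin n → F => g (Fin.cons (T x) y) :=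
    (hg.comp (measurePreserving_cons ν n).measurable).comp measurable_prodMk_left
  rw [firstMarginal, firstMarginal, ← hpi.lintegral_comp hgx]
  congr 1
  refine lintegral_congr fun y => congrArg g (funext fun j => ?_)
  refine Fin.cases ?_ (fun k => ?_) j <;> rfl

variable {n : ℕ} [LinearOrder (UpperHemisphere (n + 1))]

/-- The second moment of the first marginal of the vertex kernel does not depend on the radius. -/
lemma lintegral_firstMarginal_vertexKernel_sq
    (hle : MeasurableSet {q : UpperHemisphere (n + 1) × UpperHemisphere (n + 1) | q.1 ≤ q.2})
    {B : Set (Fin (n + 1) → UpperHemisphere (n + 1))} (hB : MeasurableSet B)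
    (Θ : Measure (UpperHemisphere (n + 1))) [IsProbabilityMeasure Θ] {r ρ : ℝ}
    (hr : 0 < r) (hρ : 0 < ρ) :
    ∫⁻ x, firstMarginal (hittingLaw r Θ) (vertexKernel r B) x ^ 2 ∂(hittingLaw r Θ)
      = ENNReal.ofReal (sigmaB ρ Θ B) := by
  have := isProbabilityMeasure_hittingLaw Θ hr
  have := isProbabilityMeasure_hittingLaw Θ hρ
  have hc : 0 < r / ρ := div_pos hr hρ
  have hrc : r / ρ * ρ = r := div_mul_cancel₀ r hρ.ne'
  have hmp := measurePreserving_dilate Θ hc hρ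
  rw [hrc] at hmp
  have h1 : (fun q : Fin (n + 1) → ℝ × UpperHemisphere (n + 1) =>
      vertexKernel r B (fun j => dilate (r / ρ) (q j))) = vertexKernel ρ B := funext fun q => by
    rw [← vertexKernel_dilate hc ρ B q, hrc]
  have hk := measurable_kernelB hle hB ρ
  rw [lintegral_firstMarginal_sq_comp hmp (measurable_vertexKernel hle hB r), h1,
    lintegral_firstMarginal_sq_congr _ (vertexKernel_ae_eq Θ hρ B),
    lintegral_firstMarginal_sq_eq _ hk.ennreal_ofReal
      fun σ q => by rw [kernelB_comp_perm],
    sigmaB, ofReal_integral_eq_lintegral_ofReal]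
  · simp_rw [ENNReal.ofReal_mul (kernelB_nonneg ρ B _)]
  · refine Integrable.of_bound ((hk.comp (by fun_prop)).mul
      (hk.comp (by fun_prop))).aestronglyMeasurable 1 (Eventually.of_forall fun q => ?_)
    rw [Real.norm_of_nonneg (mul_nonneg (kernelB_nonneg ρ B _) (kernelB_nonneg ρ B _))]
    exact mul_le_one₀ (kernelB_le_one ρ B _) (kernelB_nonneg ρ B _) (kernelB_le_one ρ B _)
  · exact Eventually.of_forall fun q =>
      mul_nonneg (kernelB_nonneg ρ B _) (kernelB_nonneg ρ B _)

/-! ### Finiteness of the vertex count and the conclusion -/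

lemma vertexKernel_mono {d : ℕ} [LinearOrder (UpperHemisphere d)]
    (B : Set (Fin d → UpperHemisphere d)) {r s : ℝ} (hrs : r ≤ s)
    (q : Fin d → ℝ × UpperHemisphere d) : vertexKernel r B q ≤ vertexKernel s B q :=
  Set.indicator_le_indicator_apply_of_subset (s := vertexSet r B) (t := vertexSet s B)
    (fun _ hq => ⟨hq.1.imp fun _ h => ⟨Metric.closedBall_subset_closedBall hrs h.1, h.2⟩, hq.2⟩)
    zero_le_one

lemma ae_vertexCount_ne_top {Ω : Type*} [MeasurableSpace Ω] {P : Measure Ω} {lam : ℝ}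
    (hlam : 0 < lam)
    (hle : MeasurableSet {q : UpperHemisphere (n + 1) × UpperHemisphere (n + 1) | q.1 ≤ q.2})
    {B : Set (Fin (n + 1) → UpperHemisphere (n + 1))} (hB : MeasurableSet B)
    {Θ : Measure (UpperHemisphere (n + 1))} [IsProbabilityMeasure Θ]
    {X : ℕ → Ω → ℝ × UpperHemisphere (n + 1)}
    (hX : IsStationaryPoissonHyperplaneProcess X lam Θ P) (r : ℝ) :
    ∀ᵐ ω ∂P, vertexCount X (Metric.closedBall 0 r) B ω ≠ ∞ := by
  -- Enlarging the radius to `max r 1` makes the strip law a probability measure also when `r ≤ 0`;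
  -- the larger count has finite mean and dominates the original one.
  have hs : 0 < max r 1 := lt_max_of_lt_right one_pos
  have hg := measurable_vertexKernel hle hB (max r 1)
  have := isProbabilityMeasure_hittingLaw Θ hs
  have hint : ∫⁻ ω, uStat X (vertexKernel (max r 1) B) ω ∂P ≠ ∞ := by
    simp only [uStat]
    rw [campbellOn_strip hlam hX hs (Fin (n + 1)) _ hg (vertexKernel_eq_zero _ B)]
    refine ENNReal.mul_ne_top (ENNReal.pow_ne_top ENNReal.ofReal_ne_top) (ne_top_of_le_ne_top
      ENNReal.one_ne_top ?_)
    exact lintegral_le_one_of_le_one (Measure.pi fun _ => hittingLaw (max r 1) Θ)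
      (vertexKernel_le_one _ B)
  filter_upwards [ae_lt_top (measurable_uStat hX.measurable hg) hint] with ω hω
  rw [vertexCount_eq_uStat]
  refine ENNReal.div_ne_top (ne_top_of_le_ne_top hω.ne ?_) (by exact_mod_cast Nat.factorial_ne_zero _)
  exact ENNReal.tsum_le_tsum fun e => vertexKernel_mono B (le_max_left r 1) _

end PoissonHyperplane

theorem theorem3p1
    {Ω : Type*} [MeasurableSpace Ω] (P : Measure Ω) [IsProbabilityMeasure P]
    (d : ℕ) (hd : 1 ≤ d)
    (lam : ℝ) (hlam : 0 < lam)
    (Θ : Measure (PoissonHyperplane.UpperHemisphere d)) [IsProbabilityMeasure Θ]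
    (hΘ : PoissonHyperplane.Nondegenerate Θ)
    (X : ℕ → Ω → ℝ × PoissonHyperplane.UpperHemisphere d)
    (hX : PoissonHyperplane.IsStationaryPoissonHyperplaneProcess X lam Θ P)
    [LinearOrder (PoissonHyperplane.UpperHemisphere d)]
    (hle : MeasurableSet
      {q : PoissonHyperplane.UpperHemisphere d × PoissonHyperplane.UpperHemisphere d | q.1 ≤ q.2})
    (B : Set (Fin d → PoissonHyperplane.UpperHemisphere d)) (hB : MeasurableSet B)
    (ρ : ℝ) (hρ : 0 < ρ)
    (hσ : 0 < PoissonHyperplane.sigmaB ρ Θ B) :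
    (∀ r : ℝ, ∀ᵐ ω ∂P,
      PoissonHyperplane.vertexCount X (Metric.closedBall 0 r) B ω ≠ ∞) ∧
    TendstoInDistribution
      (fun (r : ℝ) (ω : Ω) =>
        ((d - 1).factorial : ℝ) / (2 * lam * r) ^ ((d : ℝ) - 1 / 2) *
          ((PoissonHyperplane.vertexCount X (Metric.closedBall 0 r) B ω).toReal -
            (2 * lam * r) ^ d / (d.factorial : ℝ) * PoissonHyperplane.meanB ρ Θ B))
      atTop (id : ℝ → ℝ) (fun _ => P)
      (gaussianReal 0 (PoissonHyperplane.sigmaB ρ Θ B).toNNReal) := by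
  obtain ⟨n, rfl⟩ : ∃ n, d = n + 1 := ⟨d - 1, by omega⟩
  refine ⟨PoissonHyperplane.ae_vertexCount_ne_top hlam hle hB hX, ?_⟩
  have hθ0 : 0 ≤ PoissonHyperplane.meanB ρ Θ B :=
    integral_nonneg fun q => PoissonHyperplane.kernelB_nonneg ρ B q
  have h := PoissonHyperplane.tendstoInDistribution_uStat hlam hX
    (PoissonHyperplane.measurable_vertexKernel hle hB)
    (fun r => PoissonHyperplane.vertexKernel_le_one r B)
    (fun r => PoissonHyperplane.vertexKernel_eq_zero r B)
    (fun r => PoissonHyperplane.vertexKernel_comp_perm r B) hθ0 hσ.le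
    (fun r hr => PoissonHyperplane.lintegral_vertexKernel hle hB Θ hr hρ)
    (fun r hr => PoissonHyperplane.lintegral_firstMarginal_vertexKernel_sq hle hB Θ hr hρ)
  simpa only [PoissonHyperplane.vertexCount_eq_uStat, ENNReal.toReal_div, ENNReal.toReal_natCast,
    Nat.add_sub_cancel] using h
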